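/- Let $K$ be an algebraically closed field of characteristic $0$ and let $X\subset\mathbb{P}^r$ be an irreducible non-degenerate (i.e. spanning $\mathbb{P}^r$) projective variety over $K$ of dimension $n$. Let $s\ge 1$ be an integer such that the codimension $r-n$ of $X$ is bigger than $s$. Then $Y:=\mathrm{Seg}(\mathbb{P}^{s-1}\times X)\subset\mathbb{P}^{s(r+1)-1}$, the image of $\mathbb{P}^{s-1}\times X$ under the Segre embedding, is $s$-identifiable. Here the $s$-th secant variety $\sigma_s(Y)$ is the Zariski closure of the union of all projective linear spaces spanned by $s$ distinct points of $Y$. The $Y$-rank of a point $p$ is the least number of distinct points of $Y$ whose linear span contains $p$. That $Y$ is $s$-identifiable means that the general point $p$ of $\sigma_s(Y)$ (i.e. every point of some nonempty dense Zariski open subset of $\sigma_s(Y)$) has $Y$-rank equal to $s$, and there is exactly one set $\{P_1,\dots,P_s\}\subset Y$ of $s$ distinct points whose linear span contains $p$. -/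

import Mathlib

open scoped LinearAlgebra.Projectivization

noncomputable section

namespace GrassmannSecants

variable {K : Type*} [Field K] {ι κ : Type*}

/-- The set of points of projective space at which all polynomials of `S` vanish. It is used only
for sets of homogeneous polynomials, where it does not depend on the chosen representatives
(see `eval_rep_eq_zero_iff`). -/
def projZeroLocus (S : Set (MvPolynomial ι K)) : Set (ℙ K (ι → K)) :=
  {p | ∀ f ∈ S, MvPolynomial.eval p.rep f = 0}

/-- Vanishing of a homogeneous polynomial at a point does not depend on the representative. -/
theorem eval_rep_eq_zero_iff {f : MvPolynomial ι K} {d : ℕ} (hf : f.IsHomogeneous d)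
    (v : ι → K) (hv : v ≠ 0) :
    MvPolynomial.eval (Projectivization.mk K v hv).rep f = 0 ↔ MvPolynomial.eval v f = 0 := by
  obtain ⟨a, ha⟩ := Projectivization.exists_smul_eq_mk_rep K v hv
  have h : MvPolynomial.eval (Projectivization.mk K v hv).rep f
      = (a : K) ^ d * MvPolynomial.eval v f := by
    rw [← ha]
    simp only [MvPolynomial.eval_eq, Finset.mul_sum]
    refine Finset.sum_congr rfl fun m hm => ?_
    have hd : ∑ i ∈ m.support, m i = d := by
      rw [← hf (MvPolynomial.mem_support_iff.mp hm), Finsupp.weight_apply, Finsupp.sum]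
      simp
    simp only [Units.smul_def, Pi.smul_apply, smul_eq_mul, mul_pow, Finset.prod_mul_distrib,
      Finset.prod_pow_eq_pow_sum, hd]
    ring
  rw [h]
  simp

/-- A set of polynomials all of which are homogeneous (of possibly different degrees). -/
def AllHomogeneous (S : Set (MvPolynomial ι K)) : Prop :=
  ∀ f ∈ S, ∃ d : ℕ, f.IsHomogeneous d

/-- The Zariski topology on projective space: the closed sets are exactly the common zero loci of
sets of homogeneous polynomials. -/
abbrev zariskiTopology (K : Type*) [Field K] (ι : Type*) : TopologicalSpace (ℙ K (ι → K)) :=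
  TopologicalSpace.ofClosed
    {Z | ∃ S : Set (MvPolynomial ι K), AllHomogeneous S ∧ Z = projZeroLocus S}
    (by
      refine ⟨{1}, ?_, ?_⟩
      · rintro f rfl
        exact ⟨0, MvPolynomial.isHomogeneous_one ι K⟩
      · ext p
        simp [projZeroLocus])
    (by
      intro A hA
      refine ⟨{f | (∃ d : ℕ, f.IsHomogeneous d) ∧ ∃ Z ∈ A, ∀ p ∈ Z,
        MvPolynomial.eval p.rep f = 0}, fun f hf => hf.1, ?_⟩
      ext p
      constructor
      · rintro hp f ⟨-, Z, hZ, h⟩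
        exact h p (hp Z hZ)
      · intro hp Z hZ
        obtain ⟨S, hS, rfl⟩ := hA hZ
        intro f hf
        exact hp f ⟨hS f hf, _, hZ, fun q hq => hq f hf⟩)
    (by
      rintro _ ⟨S, hS, rfl⟩ _ ⟨T, hT, rfl⟩
      refine ⟨{h | ∃ f ∈ S, ∃ g ∈ T, h = f * g}, ?_, ?_⟩
      · rintro _ ⟨f, hf, g, hg, rfl⟩
        obtain ⟨d, hd⟩ := hS f hf
        obtain ⟨e, he⟩ := hT g hg
        exact ⟨d + e, hd.mul he⟩
      · ext p
        constructor
        · rintro (hp | hp) _ ⟨f, hf, g, hg, rfl⟩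
          · simp [hp f hf]
          · simp [hp g hg]
        · intro hp
          by_contra hcon
          simp only [Set.mem_union, not_or] at hcon
          obtain ⟨h1, h2⟩ := hcon
          simp only [projZeroLocus, Set.mem_ofPred_eq, not_forall] at h1 h2
          obtain ⟨f, hf, hf0⟩ := h1
          obtain ⟨g, hg, hg0⟩ := h2
          have := hp (f * g) ⟨f, hf, g, hg, rfl⟩
          rw [map_mul] at this
          exact (mul_ne_zero hf0 hg0) this)

end GrassmannSecants

attribute [local instance] GrassmannSecants.zariskiTopology

namespace GrassmannSecants

/-- An irreducible, non-degenerate projective variety in the projective space on `ι → K`, as its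
set of points: a Zariski closed, irreducible (in particular nonempty) set which spans the whole
projective space. -/
structure IsNondegenerateVariety {K : Type*} [Field K] {ι : Type*}
    (X : Set (ℙ K (ι → K))) : Prop where
  isClosed : IsClosed X
  isIrreducible : IsIrreducible X
  span_eq_top : Projectivization.Subspace.span X = ⊤

/-- The dimension of a set of points of projective space: the Krull dimension of its Zariski
topology. -/
def dimension {K : Type*} [Field K] {ι : Type*} (X : Set (ℙ K (ι → K))) : WithBot ℕ∞ :=
  topologicalKrullDim X

/-- The property `P` holds for the general point of `Z`: it holds at every point of some nonempty
dense relatively Zariski open subset of `Z`. -/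
def HoldsForGeneralPoint {K : Type*} [Field K] {ι : Type*}
    (Z : Set (ℙ K (ι → K))) (P : ℙ K (ι → K) → Prop) : Prop :=
  ∃ U : Set (ℙ K (ι → K)), IsOpen U ∧ (U ∩ Z).Nonempty ∧ Z ⊆ closure (U ∩ Z) ∧
    ∀ p ∈ U ∩ Z, P p

/-- The point `p` is computed by the finite set `T` of (distinct) points of `Y`: it lies in the
projective linear span of `T`. -/
def IsComputedBy {K : Type*} [Field K] {ι : Type*}
    (Y : Set (ℙ K (ι → K))) (p : ℙ K (ι → K)) (T : Finset (ℙ K (ι → K))) : Prop :=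
  (T : Set (ℙ K (ι → K))) ⊆ Y ∧ p ∈ Projectivization.Subspace.span (T : Set (ℙ K (ι → K)))

/-- The `s`-th secant variety of `Y`: the Zariski closure of the union of all projective linear
spaces spanned by `s` distinct points of `Y`. -/
def secantVariety {K : Type*} [Field K] {ι : Type*}
    (Y : Set (ℙ K (ι → K))) (s : ℕ) : Set (ℙ K (ι → K)) :=
  closure {p | ∃ T : Finset (ℙ K (ι → K)), T.card = s ∧ IsComputedBy Y p T}

/-- `p` has `Y`-rank `s`: the integer `s` is the least number of distinct points of `Y` whose span
contains `p`. -/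
def HasRank {K : Type*} [Field K] {ι : Type*}
    (Y : Set (ℙ K (ι → K))) (p : ℙ K (ι → K)) (s : ℕ) : Prop :=
  IsLeast {t : ℕ | ∃ T : Finset (ℙ K (ι → K)), T.card = t ∧ IsComputedBy Y p T} s

/-- `p` is `Y`-identifiable: if `s` is its `Y`-rank, there is exactly one set of `s` distinct
points of `Y` whose span contains `p`. -/
def IsIdentifiable {K : Type*} [Field K] {ι : Type*}
    (Y : Set (ℙ K (ι → K))) (p : ℙ K (ι → K)) : Prop :=
  ∃ s : ℕ, HasRank Y p s ∧
    ∃! T : Finset (ℙ K (ι → K)), T.card = s ∧ IsComputedBy Y p T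

/-- `s`-identifiability holds for `Y`: the general point of the `s`-th secant variety of `Y` has
`Y`-rank `s` and is `Y`-identifiable. -/
def SIdentifiable {K : Type*} [Field K] {ι : Type*}
    (Y : Set (ℙ K (ι → K))) (s : ℕ) : Prop :=
  HoldsForGeneralPoint (secantVariety Y s) fun p => HasRank Y p s ∧ IsIdentifiable Y p

/-- The vector of all products `a i * x j`. -/
def segreVec {K : Type*} [Field K] {ι κ : Type*} (a : ι → K) (x : κ → K) : ι × κ → K :=
  fun ij => a ij.1 * x ij.2

theorem segreVec_ne_zero {K : Type*} [Field K] {ι κ : Type*} {a : ι → K} {x : κ → K}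
    (ha : a ≠ 0) (hx : x ≠ 0) : segreVec a x ≠ 0 := by
  obtain ⟨i, hi⟩ := Function.ne_iff.mp ha
  obtain ⟨j, hj⟩ := Function.ne_iff.mp hx
  exact Function.ne_iff.mpr ⟨(i, j), mul_ne_zero hi hj⟩

/-- The Segre embedding, sending `([a], [x])` to the point `[a i * x j]`. -/
def segreMap {K : Type*} [Field K] {ι κ : Type*} (p : ℙ K (ι → K)) (q : ℙ K (κ → K)) :
    ℙ K (ι × κ → K) :=
  Projectivization.mk K (segreVec p.rep q.rep) (segreVec_ne_zero p.rep_nonzero q.rep_nonzero)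

theorem segreMap_mk {K : Type*} [Field K] {ι κ : Type*} {a : ι → K} {x : κ → K}
    (ha : a ≠ 0) (hx : x ≠ 0) :
    segreMap (Projectivization.mk K a ha) (Projectivization.mk K x hx)
      = Projectivization.mk K (segreVec a x) (segreVec_ne_zero ha hx) := by
  obtain ⟨c, hc⟩ := Projectivization.exists_smul_eq_mk_rep K a ha
  obtain ⟨d, hd⟩ := Projectivization.exists_smul_eq_mk_rep K x hx
  rw [segreMap, Projectivization.mk_eq_mk_iff]
  refine ⟨c * d, ?_⟩
  rw [← hc, ← hd]
  ext ij
  simp only [segreVec, Units.smul_def, Pi.smul_apply, smul_eq_mul, Units.val_mul]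
  ring

/-- The Segre product of the projective space on `ι → K` with `X`. For `ι = Fin s` the first factor
is projective space of dimension `s - 1`. -/
def segreProduct {K : Type*} [Field K] (ι : Type*) {κ : Type*} (X : Set (ℙ K (κ → K))) :
    Set (ℙ K (ι × κ → K)) :=
  {z | ∃ p : ℙ K (ι → K), ∃ q ∈ X, z = segreMap p q}

end GrassmannSecants

end

/-! A point in the span of `s` points of the Segre variety is a tensor `∑ a_l ⊗ x_l` with the `x_l`
in the affine cone `C` over `X`. If the matrix of the `a_l` is invertible and the `x_l` are
independent, the slices of the tensor span `⟨x_1, …, x_s⟩`. The second factors `y_t` of any other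
decomposition span at least this space, so there are at least `s` of them, and exactly `s` of them
span the same space. If that space meets `C` only in the lines through the `x_l`, each `y_t` is a
multiple of some `x_l`, and independence forces the two decompositions to agree
(`exists_segreVec_eq_of_sum_segreVec_eq`).

It remains to see that the span of `s` general points of `C` meets `C` only in the lines through
them, a general trisecant lemma (`exists_general_tuples`). Projection from a general point of `C`
reduces this to `s = 2`. Suppose the generic secant line carries a third point `z = c x₀ + x₁`, with
`c` algebraic over the function field of `C × C`. Differentiating `z` along both factors, as in
Terracini's lemma, puts the tangent spaces at `x₀` and `x₁` inside `T_z + ⟨x₀⟩`, of dimension at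
most `dim C + 1`. Hence, for a general point `a`, the ratio of two linear forms vanishing on `T_a`
has zero derivative on `C`. In characteristic `0` this ratio is constant, so a nonzero linear form
vanishes on `C`, against nondegeneracy (`not_generic_trisecant`).

Passing between general points and the generic point is the role of `elimination_alternative`: over
an irreducible base an algebraic system is either unsolvable over the general point, or solvable
there and also in an algebraic extension of the function field. The same tool shows that the general
point of the secant variety is a tensor of the good kind (`exists_lift_of_general`,
`sIdentifiable_of_general_tuples`). Finally `trdeg_affineCone_le` converts the topological dimension
of `X` into a bound for the transcendence degree used throughout. -/

noncomputable section
namespace GrassmannSecants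

/-! ### Derivations of fields in characteristic zero. -/

section Derivations

/-- A derivation of a domain with values in an algebraic field extension of its fraction field
extends to this field in characteristic zero. -/
theorem exists_derivation_extending {K A F : Type*} [Field K] [CommRing A] [IsDomain A]
    [Field F] [CharZero F] [Algebra K A] [Algebra K F] [Algebra A F] [IsScalarTower K A F]
    [FaithfulSMul A F] [Algebra.IsAlgebraic A F] (D : Derivation K A F) :
    ∃ D' : Derivation K F F, ∀ a, D' (algebraMap A F a) = D a := by
  let _ := FractionRing.liftAlgebra A F
  have : IsScalarTower A (FractionRing A) F := FractionRing.isScalarTower_liftAlgebra A F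
  have : Algebra.IsAlgebraic (FractionRing A) F :=
    Algebra.IsAlgebraic.extendScalars (IsFractionRing.injective A (FractionRing A))
  have : CharZero (FractionRing A) :=
    ⟨fun m n h => by simpa using congrArg (algebraMap (FractionRing A) F) h⟩
  -- Localizations and separable algebraic extensions are formally étale, so the differentials of
  -- `F` are the base change of those of `A` and `D` extends.
  have : Algebra.FormallyEtale A (FractionRing A) :=
    Algebra.FormallyEtale.of_isLocalization (nonZeroDivisors A)
  have : Algebra.FormallyEtale (FractionRing A) F := Algebra.FormallyEtale.of_isSeparable _ _
  have : Algebra.FormallyEtale A F := Algebra.FormallyEtale.comp A (FractionRing A) F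
  have h := KaehlerDifferential.isBaseChange_of_formallyEtale K A F
  refine ⟨(h.lift D.liftKaehlerDifferential).compDer (KaehlerDifferential.D K F), fun a => ?_⟩
  have := h.lift_eq D.liftKaehlerDifferential (KaehlerDifferential.D K A a)
  rw [KaehlerDifferential.map_D, Derivation.liftKaehlerDifferential_comp_D] at this
  exact this

/-- A derivation killing `s` kills everything algebraic over `s`. -/
theorem derivation_eq_zero_of_isAlgebraic {K F : Type*} [Field K] [Field F] [CharZero F]
    [Algebra K F] (D : Derivation K F F) {s : Set F} (hs : ∀ x ∈ s, D x = 0) {x : F}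
    (hx : IsAlgebraic (Algebra.adjoin K s) x) : D x = 0 := by
  let E : Subfield F :=
    { carrier := {y | D y = 0}
      mul_mem' := fun {a b} ha hb => by
        simp only [Set.mem_ofPred_eq] at *
        simp [ha, hb]
      one_mem' := by simp
      add_mem' := fun {a b} ha hb => by
        simp only [Set.mem_ofPred_eq] at *
        simp [ha, hb]
      zero_mem' := by simp
      neg_mem' := fun {a} ha => by
        simp only [Set.mem_ofPred_eq] at *
        simp [ha]
      inv_mem' := fun a ha => by
        simp only [Set.mem_ofPred_eq] at *
        rw [Derivation.leibniz_inv, ha, smul_zero] }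
  -- The elements killed by `D` form a field `E` over which `D` is linear. Applied to the minimal
  -- polynomial `p` of `x` over `E`, this gives `p'(x) * D x = 0`, and `p'(x) ≠ 0` by separability.
  let D' : Derivation E F F := Derivation.mk'
    { toFun := D
      map_add' := map_add D
      map_smul' := fun e y => by
        have : D (e : F) = 0 := e.2
        simp [Subfield.smul_def, this] }
    (fun a b => by simp)
  have hsub : ∀ y ∈ Algebra.adjoin K s, y ∈ E := fun y hy => by
    induction hy using Algebra.adjoin_induction with
    | mem y hy => exact hs y hy
    | algebraMap r => exact D.map_algebraMap r
    | add a b _ _ ha hb => exact E.add_mem ha hb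
    | mul a b _ _ ha hb => exact E.mul_mem ha hb
  have hxE : IsAlgebraic E x := by
    obtain ⟨p, hp0, hp⟩ := hx
    let ι : Algebra.adjoin K s →+* E :=
      { toFun := fun y => ⟨y, hsub y y.2⟩
        map_one' := rfl
        map_mul' := fun _ _ => rfl
        map_zero' := rfl
        map_add' := fun _ _ => rfl }
    have hι : Function.Injective ι := fun a b h =>
      Subtype.ext (congrArg (fun y : E => (y : F)) h)
    refine ⟨p.map ι, (Polynomial.map_ne_zero_iff hι).2 hp0, ?_⟩
    rw [Polynomial.aeval_def, Polynomial.eval₂_map]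
    exact hp
  have hD : D' x = D x := rfl
  have h := D'.map_aeval (minpoly E x) x
  rw [minpoly.aeval, map_zero] at h
  rw [← hD]
  refine (smul_eq_zero.1 h.symm).resolve_left ?_
  have hsep : (minpoly E x).Separable := (minpoly.irreducible hxE.isIntegral).separable
  exact hsep.aeval_derivative_ne_zero (minpoly.aeval E x)

/-- The partial derivatives with respect to a transcendence basis. -/
theorem exists_partial_derivation {K L ι : Type*} [Field K] [Field L] [CharZero L] [Algebra K L]
    {x : ι → L} (hx : IsTranscendenceBasis K x) (c : ι → L) :
    ∃ D : Derivation K L L, ∀ i, D (x i) = c i := by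
  let _ : Algebra (MvPolynomial ι K) L := (MvPolynomial.aeval x).toRingHom.toAlgebra
  have halg : ∀ p, algebraMap (MvPolynomial ι K) L p = MvPolynomial.aeval x p := fun _ => rfl
  have : IsScalarTower K (MvPolynomial ι K) L := IsScalarTower.of_algebraMap_eq fun r => by
    rw [halg, MvPolynomial.algebraMap_eq, MvPolynomial.aeval_C]
  have : FaithfulSMul (MvPolynomial ι K) L :=
    (faithfulSMul_iff_algebraMap_injective _ _).2 hx.1
  have : Algebra.IsAlgebraic (MvPolynomial ι K) L := by
    have h := hx.isAlgebraic
    refine ⟨fun y => ?_⟩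
    obtain ⟨p, hp0, hp⟩ := h.isAlgebraic y
    let e : MvPolynomial ι K ≃ₐ[K] Algebra.adjoin K (Set.range x) := hx.1.aevalEquiv
    refine ⟨p.map (e.symm : _ →+* MvPolynomial ι K),
      (Polynomial.map_ne_zero_iff e.symm.injective).2 hp0, ?_⟩
    rw [Polynomial.aeval_def, Polynomial.eval₂_map]
    convert hp using 1
    rw [Polynomial.aeval_def]
    congr 1
    ext z
    change MvPolynomial.aeval x (e.symm z) = z
    have := hx.1.algebraMap_aevalEquiv (e.symm z)
    rw [← this]
    simp [e]
  obtain ⟨D, hD⟩ := exists_derivation_extending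
    (MvPolynomial.mkDerivation K c : Derivation K (MvPolynomial ι K) L)
  refine ⟨D, fun i => ?_⟩
  have := hD (MvPolynomial.X i)
  rwa [halg, MvPolynomial.aeval_X, MvPolynomial.mkDerivation_X] at this

/-- Elements killed by all partial derivatives are algebraic. -/
theorem isAlgebraic_of_forall_derivation_eq_zero {K L ι : Type*} [Field K] [Field L] [CharZero L]
    [Algebra K L] [Fintype ι] {x : ι → L} (hx : IsTranscendenceBasis K x)
    (D : ι → Derivation K L L) [DecidableEq ι]
    (hD : ∀ i j, D i (x j) = if i = j then 1 else 0) {ρ : L}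
    (hρ : ∀ i, D i ρ = 0) : IsAlgebraic K ρ := by
  by_contra hcon
  have hind : AlgebraicIndepOn K id ({ρ} : Set L) :=
    algebraicIndependent_unique_type_iff.2 hcon
  obtain ⟨t, ht, htb⟩ := exists_isTranscendenceBasis_superset hind
  obtain ⟨D', hD'⟩ := exists_partial_derivation htb (fun _ => 1)
  have h1 : D' ρ = 1 := hD' ⟨ρ, ht rfl⟩
  -- This correction kills the transcendence basis `x`, hence everything, but it still sends `ρ` to
  -- `1`.
  let D'' : Derivation K L L := D' - ∑ i, D' (x i) • D i
  have hsum : ∀ y, D'' y = D' y - ∑ i, D' (x i) * D i y := fun y => by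
    have : (∑ i, D' (x i) • D i) y = ∑ i, D' (x i) * D i y := by
      rw [← Derivation.coeFnAddMonoidHom_apply, map_sum, Finset.sum_apply]
      rfl
    rw [← this]
    rfl
  have h0 : D'' ρ = 0 := derivation_eq_zero_of_isAlgebraic D'' (s := Set.range x)
    (by
      rintro _ ⟨j, rfl⟩
      simp [hsum, hD]) (hx.isAlgebraic.isAlgebraic ρ)
  rw [hsum, h1] at h0
  simp [hρ] at h0

/-- A finite family contains an algebraically independent subfamily over which it is
algebraic. -/
theorem exists_maximal_algebraicIndepOn (K : Type*) {L κ : Type*} [Field K] [Field L]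
    [Algebra K L] [Finite κ] (x : κ → L) :
    ∃ β : Finset κ, AlgebraicIndepOn K x (β : Set κ) ∧
      ∀ k, IsAlgebraic (Algebra.adjoin K (x '' (β : Set κ))) (x k) := by
  classical
  cases nonempty_fintype κ
  obtain ⟨β, hβ, hmax⟩ := Finset.exists_max_image
    (Finset.univ.filter fun β : Finset κ => AlgebraicIndepOn K x (β : Set κ)) Finset.card
    ⟨∅, by
      simp only [Finset.mem_filter, Finset.mem_univ, true_and, Finset.coe_empty]
      exact algebraicIndependent_empty_type_iff.2 (algebraMap K L).injective⟩
  simp only [Finset.mem_filter, Finset.mem_univ, true_and] at hβ hmax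
  refine ⟨β, hβ, fun k => ?_⟩
  by_cases hk : k ∈ β
  · exact isAlgebraic_algebraMap
      (⟨x k, Algebra.subset_adjoin ⟨k, hk, rfl⟩⟩ : Algebra.adjoin K (x '' (β : Set κ)))
  · by_contra hcon
    have := hmax (insert k β) (by
      rw [Finset.coe_insert]
      exact (AlgebraicIndepOn.insert_iff (by simpa using hk)).2 ⟨hβ, hcon⟩)
    rw [Finset.card_insert_of_notMem hk] at this
    omega

/-- The evaluation of derivations at a vector. -/
def derivationEval (K : Type*) {F κ : Type*} [Field K] [Field F] [Algebra K F] (z : κ → F) :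
    Derivation K F F →ₗ[F] κ → F where
  toFun D k := D (z k)
  map_add' _ _ := rfl
  map_smul' _ _ := rfl

/-- A derivation is determined on all `z k` by its values on a maximal algebraically independent
subfamily. Geometrically, the tangent space at `z` is no larger than the transcendence degree of
`z`. -/
theorem finrank_range_derivationEval_le {K F κ : Type*} [Field K] [Field F] [CharZero F]
    [Algebra K F] [Finite κ] (z : κ → F) {N : ℕ}
    (hN : ∀ γ : Finset κ, AlgebraicIndepOn K z (γ : Set κ) → γ.card ≤ N) :
    Module.finrank F (LinearMap.range (derivationEval K z)) ≤ N := by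
  obtain ⟨γ, hγ, halg⟩ := exists_maximal_algebraicIndepOn K z
  let π : (κ → F) →ₗ[F] (γ → F) := LinearMap.funLeft F F Subtype.val
  have hinj : Function.Injective (π.domRestrict (LinearMap.range (derivationEval K z))) := by
    rw [injective_iff_map_eq_zero]
    rintro ⟨_, D, rfl⟩ h
    ext k
    refine derivation_eq_zero_of_isAlgebraic D (s := z '' (γ : Set κ)) ?_ (halg k)
    rintro _ ⟨i, hi, rfl⟩
    exact congrFun h ⟨i, hi⟩
  refine (LinearMap.finrank_le_finrank_of_injective hinj).trans ?_
  simpa using hN γ hγ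

end Derivations

end GrassmannSecants
end

noncomputable section
namespace GrassmannSecants

/-! ### Elimination: general points versus the generic point. -/

section Elimination

open MvPolynomial Topology

universe u

/-- A constructible set containing a generic point contains a neighbourhood of it. -/
theorem exists_isOpen_subset_of_isConstructible {T : Type*} [TopologicalSpace T] {x : T}
    (hx : ∀ U : Set T, IsOpen U → U.Nonempty → x ∈ U) {s : Set T} (hs : IsConstructible s)
    (hxs : x ∈ s) : ∃ U : Set T, IsOpen U ∧ x ∈ U ∧ U ⊆ s := by
  -- The statement is made symmetric under complements so that the induction on constructible sets
  -- closes.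
  suffices h : (x ∈ s → ∃ U : Set T, IsOpen U ∧ x ∈ U ∧ U ⊆ s) ∧
      (x ∉ s → ∃ U : Set T, IsOpen U ∧ x ∈ U ∧ U ⊆ sᶜ) from h.1 hxs
  clear hxs
  induction hs using IsConstructible.empty_union_induction with
  | open_retrocompact U hU _ =>
    refine ⟨fun h => ⟨U, hU, h, subset_rfl⟩, fun h => ⟨Set.univ, isOpen_univ, trivial, ?_⟩⟩
    intro y _ hy
    exact h (hx U hU ⟨y, hy⟩)
  | union s _ t _ hs ht =>
    constructor
    · rintro (h | h)
      · obtain ⟨U, hU, hxU, hUs⟩ := hs.1 h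
        exact ⟨U, hU, hxU, hUs.trans Set.subset_union_left⟩
      · obtain ⟨U, hU, hxU, hUs⟩ := ht.1 h
        exact ⟨U, hU, hxU, hUs.trans Set.subset_union_right⟩
    · intro h
      obtain ⟨U, hU, hxU, hUs⟩ := hs.2 fun h' => h (Or.inl h')
      obtain ⟨V, hV, hxV, hVt⟩ := ht.2 fun h' => h (Or.inr h')
      refine ⟨U ∩ V, hU.inter hV, ⟨hxU, hxV⟩, fun y hy hyst => ?_⟩
      exact hyst.elim (hUs hy.1) (hVt hy.2)
  | compl s _ hs =>
    refine ⟨hs.2, fun h => ?_⟩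
    rw [compl_compl]
    exact hs.1 (not_not.1 h)

/-- The coordinate ring of a set of points of affine space. -/
def CoordRing {K : Type*} [Field K] {σ : Type*} (W : Set (σ → K)) : Type _ :=
  MvPolynomial σ K ⧸ vanishingIdeal K W

namespace CoordRing

variable {K : Type*} [Field K] {σ : Type*} (W : Set (σ → K))

instance : CommRing (CoordRing W) :=
  inferInstanceAs (CommRing (MvPolynomial σ K ⧸ vanishingIdeal K W))

instance : Algebra K (CoordRing W) :=
  inferInstanceAs (Algebra K (MvPolynomial σ K ⧸ vanishingIdeal K W))

/-- The regular function defined by a polynomial. -/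
def mk : MvPolynomial σ K →ₐ[K] CoordRing W := Ideal.Quotient.mkₐ K (vanishingIdeal K W)

theorem mk_surjective : Function.Surjective (mk W) := Ideal.Quotient.mk_surjective

variable {W} in
theorem mk_eq_zero_iff {p : MvPolynomial σ K} : mk W p = 0 ↔ p ∈ vanishingIdeal K W :=
  Ideal.Quotient.eq_zero_iff_mem

instance [Finite σ] : Algebra.FiniteType K (CoordRing W) :=
  Algebra.FiniteType.of_surjective (mk W) (mk_surjective W)

variable {W} in
theorem isDomain (hW : (vanishingIdeal K W).IsPrime) : IsDomain (CoordRing W) :=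
  Ideal.Quotient.isDomain _

/-- The coordinate functions. -/
def coord (i : σ) : CoordRing W := mk W (X i)

theorem aeval_coord (p : MvPolynomial σ K) : aeval (coord W) p = mk W p := by
  have : aeval (coord W) = mk W := algHom_ext fun i => by simp [coord]
  rw [this]

/-- Evaluation of regular functions at a point. -/
def evalAt (w : W) : CoordRing W →ₐ[K] K :=
  Ideal.Quotient.liftₐ _ (aeval (w : σ → K)) fun _ ha => ha w w.2

@[simp] theorem evalAt_mk (w : W) (p : MvPolynomial σ K) :
    evalAt W w (mk W p) = aeval (w : σ → K) p := rfl

@[simp] theorem evalAt_coord (w : W) (i : σ) : evalAt W w (coord W i) = (w : σ → K) i := by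
  simp [coord]

end CoordRing

open CoordRing

/-- Over a nonempty open subset of the base, points of the base lift to an algebra of finite type
containing it. -/
theorem exists_lift_of_injective {K R S : Type*} [Field K] [IsAlgClosed K] [CommRing R] [IsDomain R]
    [Algebra K R] [Algebra.FiniteType K R] [CommRing S] [Algebra R S] [Algebra K S]
    [IsScalarTower K R S] [Algebra.FiniteType R S]
    (hinj : Function.Injective (algebraMap R S)) :
    ∃ a : R, a ≠ 0 ∧ ∀ θ : R →ₐ[K] K, θ a ≠ 0 →
      ∃ Θ : S →ₐ[K] K, ∀ r, Θ (algebraMap R S r) = θ r := by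
  have : IsNoetherianRing R := Algebra.FiniteType.isNoetherianRing K R
  have : Algebra.FinitePresentation R S := Algebra.FinitePresentation.of_finiteType.1 inferInstance
  have : Algebra.FiniteType K S := Algebra.FiniteType.trans (S := R) inferInstance inferInstance
  have hcons := PrimeSpectrum.isConstructible_range_comap
    (f := algebraMap R S) (RingHom.finitePresentation_algebraMap.2 inferInstance)
  obtain ⟨U, hU, hηU, hUs⟩ := exists_isOpen_subset_of_isConstructible
    (x := (⟨⊥, Ideal.isPrime_bot⟩ : PrimeSpectrum R)) (fun V hV hne => by
      obtain ⟨y, hy⟩ := hne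
      refine (PrimeSpectrum.le_iff_specializes _ y |>.1 ?_).mem_open hV hy
      exact (bot_le : (⊥ : Ideal R) ≤ y.asIdeal)) hcons (by
      -- The generic point of `R` lies in the image of the spectrum of `S` because `R` embeds in
      -- `S`. By Chevalley the image is constructible, so it contains a basic open set.
      obtain ⟨q, hq, h⟩ := Ideal.exists_comap_eq_of_mem_minimalPrimes_of_injective hinj ⊥
        (by rw [IsDomain.minimalPrimes_eq_singleton_bot]; rfl)
      exact ⟨⟨q, hq⟩, PrimeSpectrum.ext h⟩)
  obtain ⟨_, ⟨a, rfl⟩, ha, haU⟩ :=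
    PrimeSpectrum.isTopologicalBasis_basic_opens.exists_subset_of_mem_open hηU hU
  refine ⟨a, fun h => ha (by simp [h]), fun θ hθ => ?_⟩
  obtain ⟨q, hq⟩ := hUs (haU (show (⟨RingHom.ker θ, RingHom.ker_isPrime θ⟩ : PrimeSpectrum R) ∈
    (PrimeSpectrum.basicOpen a : Set (PrimeSpectrum R)) from hθ))
  -- A maximal ideal over `q` has residue field `K` by the Nullstellensatz, and it still lies over
  -- the maximal ideal `ker θ`.
  obtain ⟨M, hM, hqM⟩ := Ideal.exists_le_maximal q.asIdeal q.2.ne_top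
  let _ : Field (S ⧸ M) := Ideal.Quotient.field M
  have : Module.Finite K (S ⧸ M) := finite_of_finite_type_of_isJacobsonRing K (S ⧸ M)
  let e : K ≃ₐ[K] S ⧸ M := AlgEquiv.ofBijective (Algebra.ofId K (S ⧸ M))
    IsAlgClosed.algebraMap_bijective_of_isIntegral
  let Θ : S →ₐ[K] K := (e.symm : (S ⧸ M) →ₐ[K] K).comp (Ideal.Quotient.mkₐ K M)
  refine ⟨Θ, fun r => ?_⟩
  have hr : r - algebraMap K R (θ r) ∈ RingHom.ker θ := by
    rw [RingHom.mem_ker, map_sub, AlgHom.commutes]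
    simp
  have hr' : algebraMap R S (r - algebraMap K R (θ r)) ∈ M := by
    apply hqM
    have := congrArg PrimeSpectrum.asIdeal hq
    change q.asIdeal.comap (algebraMap R S) = RingHom.ker θ at this
    rw [← this] at hr
    exact hr
  have h0 : Θ (algebraMap R S (r - algebraMap K R (θ r))) = 0 := by
    change e.symm (Ideal.Quotient.mk M _) = 0
    rw [Ideal.Quotient.eq_zero_iff_mem.2 hr', map_zero]
  rw [map_sub, map_sub, sub_eq_zero, ← IsScalarTower.algebraMap_apply, AlgHom.commutes] at h0
  simpa using h0

open TensorProduct in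
/-- An algebra of finite type containing a domain has a point over the generic point. -/
theorem exists_generic_point_of_injective {R S : Type u} [CommRing R] [IsDomain R]
    [CommRing S] [Algebra R S] [Algebra.FiniteType R S]
    (hinj : Function.Injective (algebraMap R S)) :
    ∃ (F : Type u) (_ : Field F) (_ : Algebra R F), FaithfulSMul R F ∧
      Algebra.IsAlgebraic R F ∧ Nonempty (S →ₐ[R] F) := by
  let Q := FractionRing R
  -- The generic fibre is nonzero by flatness of the fraction field. The residue field of any of its
  -- closed points is finite over `Q` by Zariski's lemma.
  have : Nontrivial (Q ⊗[R] S) := by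
    have h := Module.Flat.lTensor_preserves_injective_linearMap (M := Q)
      (Algebra.linearMap R S) hinj
    exact ((h.comp (TensorProduct.rid R Q).symm.injective)).nontrivial
  obtain ⟨m, hm⟩ := Ideal.exists_maximal (Q ⊗[R] S)
  let _ : Field ((Q ⊗[R] S) ⧸ m) := Ideal.Quotient.field m
  have : Module.Finite Q ((Q ⊗[R] S) ⧸ m) := finite_of_finite_type_of_isJacobsonRing Q _
  have hQalg : Algebra.IsAlgebraic Q ((Q ⊗[R] S) ⧸ m) := Algebra.IsAlgebraic.of_finite _ _
  refine ⟨(Q ⊗[R] S) ⧸ m, inferInstance, inferInstance, ?_, ?_, ⟨?_⟩⟩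
  · rw [faithfulSMul_iff_algebraMap_injective, IsScalarTower.algebraMap_eq R Q]
    exact (algebraMap Q _).injective.comp (IsFractionRing.injective R Q)
  · exact (IsFractionRing.comap_isAlgebraic_iff (A := R) (K := Q)).2 hQalg
  · exact ((Ideal.Quotient.mkₐ Q m).restrictScalars R).comp Algebra.TensorProduct.includeRight

/-- Substitution of elements `x` of `R` for the first group of variables. -/
def elimMap {K R : Type*} [Field K] [CommRing R] [Algebra K R] {σ τ : Type*} (x : σ → R) :
    MvPolynomial (σ ⊕ τ) K →ₐ[K] MvPolynomial (Option τ) R :=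
  aeval (Sum.elim (fun i => C (x i)) fun j => X (some j))

/-- The ideal of the incidence variety. -/
def elimIdeal {K R : Type*} [Field K] [CommRing R] [Algebra K R] {σ τ : Type*} (x : σ → R)
    (Q : Set (MvPolynomial (σ ⊕ τ) K)) (g : MvPolynomial (σ ⊕ τ) K) :
    Ideal (MvPolynomial (Option τ) R) :=
  -- Rabinowitsch's trick: the extra variable `none` is an inverse of `g`, so that `g ≠ 0` becomes
  -- an equation.
  Ideal.span (elimMap x '' Q ∪ {X none * elimMap x g - 1})

/-- The coordinate ring of the incidence variety. -/
abbrev ElimRing {K R : Type*} [Field K] [CommRing R] [Algebra K R] {σ τ : Type*} (x : σ → R)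
    (Q : Set (MvPolynomial (σ ⊕ τ) K)) (g : MvPolynomial (σ ⊕ τ) K) : Type _ :=
  MvPolynomial (Option τ) R ⧸ elimIdeal x Q g

/-- Points of the incidence variety are solutions of the system; the next lemma is the converse, for
points with values in `K`. -/
theorem aeval_of_hom {K R : Type*} [Field K] [CommRing R] [Algebra K R] {σ τ : Type*} (x : σ → R)
    (Q : Set (MvPolynomial (σ ⊕ τ) K)) (g : MvPolynomial (σ ⊕ τ) K)
    {B : Type*} [CommRing B] [Nontrivial B] [Algebra K B] (θ : ElimRing x Q g →ₐ[K] B) :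
    (∀ q ∈ Q, aeval (Sum.elim (fun i => θ (algebraMap R _ (x i)))
        fun j => θ (Ideal.Quotient.mk _ (X (some j)))) q = 0) ∧
    aeval (Sum.elim (fun i => θ (algebraMap R _ (x i)))
        fun j => θ (Ideal.Quotient.mk _ (X (some j)))) g ≠ 0 := by
  have h : aeval (Sum.elim (fun i => θ (algebraMap R _ (x i)))
        fun j => θ (Ideal.Quotient.mk _ (X (some j)))) =
        (θ.comp (Ideal.Quotient.mkₐ K (elimIdeal x Q g))).comp (elimMap x) := by
    apply algHom_ext
    rintro (i | j)
    · simp only [aeval_X, Sum.elim_inl, AlgHom.comp_apply, elimMap]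
      rfl
    · simp only [aeval_X, Sum.elim_inr, AlgHom.comp_apply, elimMap]
      rfl
  have hg : Ideal.Quotient.mk (elimIdeal x Q g) (X none * elimMap x g - 1) = 0 :=
    Ideal.Quotient.eq_zero_iff_mem.2 (Ideal.subset_span (Or.inr rfl))
  rw [h]
  constructor
  · intro q hq
    change θ (Ideal.Quotient.mk _ (elimMap x q)) = 0
    have : Ideal.Quotient.mk (elimIdeal x Q g) (elimMap x q) = 0 :=
      Ideal.Quotient.eq_zero_iff_mem.2 (Ideal.subset_span (Or.inl ⟨q, hq, rfl⟩))
    rw [this, map_zero]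
  · intro h0
    change θ (Ideal.Quotient.mk _ (elimMap x g)) = 0 at h0
    have := congrArg θ hg
    rw [map_sub, map_mul, map_sub, map_mul, h0, mul_zero, map_one, map_one, map_zero] at this
    simp at this

theorem exists_hom_of_solution {K R : Type*} [Field K] [CommRing R] [Algebra K R] {σ τ : Type*}
    (x : σ → R) (Q : Set (MvPolynomial (σ ⊕ τ) K)) (g : MvPolynomial (σ ⊕ τ) K)
    (θ : R →ₐ[K] K) (c : τ → K)
    (hc : ∀ q ∈ Q, aeval (Sum.elim (fun i => θ (x i)) c) q = 0)
    (hg : aeval (Sum.elim (fun i => θ (x i)) c) g ≠ 0) :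
    ∃ Θ : ElimRing x Q g →+* K, ∀ r, Θ (algebraMap R _ r) = θ r := by
  let e : MvPolynomial (Option τ) R →+* K := eval₂Hom (θ : R →+* K)
    (fun o => o.elim (aeval (Sum.elim (fun i => θ (x i)) c) g)⁻¹ c)
  have he : ∀ q : MvPolynomial (σ ⊕ τ) K, e (elimMap x q) = aeval (Sum.elim (fun i => θ (x i)) c) q := by
    intro q
    let e' : MvPolynomial (Option τ) R →ₐ[K] K := { e with
      commutes' := fun r => by
        change e (C (algebraMap K _ r)) = _
        simp [e] }
    have : e'.comp (elimMap x) = aeval (Sum.elim (fun i => θ (x i)) c) := by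
      apply algHom_ext
      rintro (i | j)
      · simp only [aeval_X, Sum.elim_inl, AlgHom.comp_apply, elimMap]
        change e (C _) = _
        simp [e]
      · simp only [aeval_X, Sum.elim_inr, AlgHom.comp_apply, elimMap]
        change e (X _) = _
        simp [e]
    exact congrArg (fun f => f q) this
  refine ⟨Ideal.Quotient.lift _ e fun a ha => ?_, fun r => ?_⟩
  · have : elimIdeal x Q g ≤ RingHom.ker e := by
      rw [elimIdeal, Ideal.span_le]
      rintro _ (⟨q, hq, rfl⟩ | rfl)
      · change e _ = 0
        rw [he, hc q hq]
      · change e _ = 0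
        have hX : e (X none) = (aeval (Sum.elim (fun i => θ (x i)) c) g)⁻¹ := by simp [e]
        rw [map_sub, map_mul, he, map_one, hX, inv_mul_cancel₀ hg, sub_self]
    exact this ha
  · change e (C r) = _
    simp [e]

/-- Elimination of the variables `τ` from the conditions `q = 0` for `q ∈ Q` and `g ≠ 0`: over the
general point of an irreducible set either they have no solution, or they have one; in the
latter case they also have a solution over the generic point. -/
theorem elimination_alternative {K : Type u} [Field K] [IsAlgClosed K] {σ τ : Type} [Finite σ]
    [Finite τ] (W : Set (σ → K)) (hW : (vanishingIdeal K W).IsPrime)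
    (Q : Set (MvPolynomial (σ ⊕ τ) K)) (g : MvPolynomial (σ ⊕ τ) K) :
    (∃ a ∉ vanishingIdeal K W, ∀ w ∈ W, aeval w a ≠ 0 → ∀ c : τ → K,
      (∀ q ∈ Q, aeval (Sum.elim w c) q = 0) → aeval (Sum.elim w c) g = 0) ∨
    ((∃ a ∉ vanishingIdeal K W, ∀ w ∈ W, aeval w a ≠ 0 → ∃ c : τ → K,
      (∀ q ∈ Q, aeval (Sum.elim w c) q = 0) ∧ aeval (Sum.elim w c) g ≠ 0) ∧
    ∃ (F : Type u) (_ : Field F) (_ : Algebra K F) (_ : Algebra (CoordRing W) F),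
      IsScalarTower K (CoordRing W) F ∧ FaithfulSMul (CoordRing W) F ∧
      Algebra.IsAlgebraic (CoordRing W) F ∧ ∃ c : τ → F,
        (∀ q ∈ Q, aeval (Sum.elim (fun i => algebraMap (CoordRing W) F (coord W i)) c) q = 0) ∧
        aeval (Sum.elim (fun i => algebraMap (CoordRing W) F (coord W i)) c) g ≠ 0) := by
  -- The dichotomy is whether the incidence variety dominates the base, that is, whether the
  -- coordinate ring of `W` embeds in that of the incidence variety.
  by_cases hinj : Function.Injective
      (algebraMap (CoordRing W) (ElimRing (coord W) Q g))
  · right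
    have := isDomain hW
    constructor
    · obtain ⟨a, ha, h⟩ := exists_lift_of_injective (K := K) hinj
      obtain ⟨a, rfl⟩ := mk_surjective W a
      refine ⟨a, fun h0 => ha (mk_eq_zero_iff.2 h0), fun w hw haw => ?_⟩
      obtain ⟨Θ, hΘ⟩ := h (evalAt W ⟨w, hw⟩) haw
      have := aeval_of_hom (coord W) Q g Θ
      simp only [hΘ, evalAt_coord] at this
      exact ⟨_, this⟩
    · obtain ⟨F, _, _, h1, h2, ⟨θ⟩⟩ := exists_generic_point_of_injective hinj
      let _ : Algebra K F := ((algebraMap (CoordRing W) F).comp (algebraMap K _)).toAlgebra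
      have : IsScalarTower K (CoordRing W) F := IsScalarTower.of_algebraMap_eq fun _ => rfl
      have := aeval_of_hom (coord W) Q g (θ.restrictScalars K)
      simp only [AlgHom.restrictScalars_apply, AlgHom.commutes] at this
      exact ⟨F, inferInstance, inferInstance, inferInstance, ‹_›, h1, h2, _, this⟩
  · left
    rw [injective_iff_map_eq_zero] at hinj
    push Not at hinj
    -- A nonzero function `a` on `W` vanishing on the incidence variety: no solution lies over a
    -- point where `a ≠ 0`.
    obtain ⟨a, ha, ha0⟩ := hinj
    obtain ⟨a, rfl⟩ := mk_surjective W a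
    refine ⟨a, fun h => ha0 (mk_eq_zero_iff.2 h), fun w hw haw c hc => ?_⟩
    by_contra hgc
    obtain ⟨Θ, hΘ⟩ := exists_hom_of_solution (coord W) Q g (evalAt W ⟨w, hw⟩) c
      (by simpa only [evalAt_coord] using hc)
      (by simpa only [evalAt_coord] using hgc)
    have := hΘ (mk W a)
    rw [ha, map_zero] at this
    exact haw this.symm

end Elimination

end GrassmannSecants
end

noncomputable section
namespace GrassmannSecants

/-! ### Polynomial vector fields tangent to an irreducible affine set. -/

section TangentFields

open MvPolynomial CoordRing

/-- The derivative of a polynomial along a polynomial vector field. -/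
def fieldApply {K κ : Type*} [Field K] [Fintype κ] (v : κ → MvPolynomial κ K)
    (f : MvPolynomial κ K) : MvPolynomial κ K :=
  ∑ k, v k * pderiv k f

/-- The chain rule for derivations and polynomials. -/
theorem derivation_aeval {K F κ : Type*} [Field K] [CommRing F] [Algebra K F] [Fintype κ]
    (D : Derivation K F F) (z : κ → F) (f : MvPolynomial κ K) :
    D (aeval z f) = ∑ k, D (z k) * aeval z (pderiv k f) := by
  classical
  induction f using MvPolynomial.induction_on with
  | C a => simp
  | add p q hp hq => simp only [map_add, hp, hq, mul_add, Finset.sum_add_distrib]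
  | mul_X p n hp =>
    simp only [map_mul, aeval_X, Derivation.leibniz, hp, smul_eq_mul, pderiv_X, map_add, mul_add,
      Finset.sum_add_distrib, Finset.mul_sum]
    congr 1
    · rw [Finset.sum_eq_single n]
      · simp [mul_comm]
      · intro k _ hk
        simp [Pi.single_eq_of_ne' hk]
      · simp
    · exact Finset.sum_congr rfl fun k _ => by ring

/-- Tangent polynomial vector fields. -/
def IsTangentField {K κ : Type*} [Field K] [Fintype κ] (C : Set (κ → K))
    (v : κ → MvPolynomial κ K) : Prop :=
  ∀ f ∈ vanishingIdeal K C, fieldApply v f ∈ vanishingIdeal K C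

theorem exists_algebraMap_eq_of_isAlgebraic {K L : Type*} [Field K] [IsAlgClosed K] [Field L]
    [Algebra K L] {x : L} (hx : IsAlgebraic K x) : ∃ y, algebraMap K L y = x := by
  have : Algebra.IsAlgebraic K (IntermediateField.adjoin K {x}) :=
    IntermediateField.isAlgebraic_adjoin (by
      rintro _ rfl
      exact hx.isIntegral)
  have h := IntermediateField.eq_bot_of_isAlgClosed_of_isAlgebraic (IntermediateField.adjoin K {x})
  have hmem : x ∈ IntermediateField.adjoin K {x} :=
    IntermediateField.mem_adjoin_simple_self K x
  rw [h] at hmem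
  exact hmem

/-- An irreducible set has polynomial tangent vector fields dual, up to a common factor, to the
differentials of a maximal algebraically independent set of coordinates. -/
theorem exists_tangent_fields {K κ : Type*} [Field K] [IsAlgClosed K] [CharZero K] [Fintype κ]
    [DecidableEq κ] (C : Set (κ → K)) (hC : (vanishingIdeal K C).IsPrime) :
    ∃ (β : Finset κ) (d : MvPolynomial κ K) (v : κ → κ → MvPolynomial κ K),
      d ∉ vanishingIdeal K C ∧ AlgebraicIndepOn K (coord C) (β : Set κ) ∧
      (∀ γ : Finset κ, AlgebraicIndepOn K (coord C) (γ : Set κ) → γ.card ≤ β.card) ∧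
      (∀ b ∈ β, ∀ b' ∈ β, v b b' - (if b = b' then d else 0) ∈ vanishingIdeal K C) ∧
      (∀ b ∈ β, IsTangentField C (v b)) ∧
      ∀ f g : MvPolynomial κ K, g ∉ vanishingIdeal K C →
        (∀ b ∈ β, g * fieldApply (v b) f - f * fieldApply (v b) g ∈ vanishingIdeal K C) →
        ∃ t : K, f - MvPolynomial.C t * g ∈ vanishingIdeal K C := by
  have hdom := isDomain hC
  let L := FractionRing (CoordRing C)
  have hcz : CharZero L := charZero_of_injective_algebraMap (algebraMap K L).injective
  have hinj : Function.Injective (algebraMap (CoordRing C) L) := IsFractionRing.injective _ _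
  let ψ : CoordRing C →ₐ[K] L := IsScalarTower.toAlgHom K (CoordRing C) L
  have hψ : Function.Injective ψ := hinj
  let x : κ → L := fun k => ψ (coord C k)
  have hx : ∀ p : MvPolynomial κ K, aeval x p = ψ (mk C p) := fun p => by
    rw [← aeval_coord, ← comp_aeval_apply]
  have hx0 : ∀ p : MvPolynomial κ K, aeval x p = 0 ↔ p ∈ vanishingIdeal K C := fun p => by
    rw [hx, map_eq_zero_iff ψ hψ, mk_eq_zero_iff]
  have hindep : ∀ γ : Set κ, AlgebraicIndepOn K x γ ↔ AlgebraicIndepOn K (coord C) γ :=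
    fun γ => AlgHom.algebraicIndependent_iff (x := fun i : γ => coord C i) ψ hψ
  obtain ⟨β, hβ, halg⟩ := exists_maximal_algebraicIndepOn K x
  have hall : Algebra.IsAlgebraic (Algebra.adjoin K (Set.range fun i : (β : Set κ) => x i)) L := by
    have hr : (Set.range fun i : (β : Set κ) => x i) = x '' (β : Set κ) := by
      rw [Set.image_eq_range]
    rw [hr]
    refine ⟨fun y => ?_⟩
    have hp : ∀ p, IsAlgebraic (Algebra.adjoin K (x '' (β : Set κ))) 
        (algebraMap (CoordRing C) L p) := by
      intro p
      obtain ⟨p, rfl⟩ := mk_surjective C p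
      change IsAlgebraic _ (ψ (mk C p))
      rw [← hx]
      induction p using MvPolynomial.induction_on with
      | C a =>
        rw [aeval_C, IsScalarTower.algebraMap_apply K (Algebra.adjoin K (x '' (β : Set κ))) L]
        exact isAlgebraic_algebraMap _
      | add p q hp hq => rw [map_add]; exact hp.add hq
      | mul_X p n hp => rw [map_mul, aeval_X]; exact hp.mul (halg n)
    obtain ⟨a, b, -, rfl⟩ := IsFractionRing.div_surjective (A := CoordRing C) y
    rw [div_eq_mul_inv]
    exact (hp a).mul (hp b).inv
  have htb : IsTranscendenceBasis K fun i : (β : Set κ) => x i :=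
    isTranscendenceBasis_iff_algebraicIndependent_isAlgebraic.2 ⟨hβ, hall⟩
  choose D hD using fun b : (β : Set κ) =>
    exists_partial_derivation htb (fun i => if b = i then 1 else 0)
  -- A common denominator of all `D b (x k)` turns the partial derivatives of the function field
  -- into polynomial vector fields. This is the factor `d` in the duality relation.
  obtain ⟨d, hd⟩ := IsLocalization.exist_integer_multiples (nonZeroDivisors (CoordRing C))
    (Finset.univ : Finset (↥(β : Set κ) × κ)) fun i => D i.1 (x i.2)
  have hd' : ∀ (b : (β : Set κ)) (k : κ), ∃ p : MvPolynomial κ K,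
      aeval x p = ψ d * D b (x k) := fun b k => by
    obtain ⟨r, hr⟩ := hd (b, k) (Finset.mem_univ _)
    obtain ⟨p, rfl⟩ := mk_surjective C r
    refine ⟨p, ?_⟩
    rw [hx]
    exact hr.trans (Algebra.smul_def _ _)
  choose w hw using hd'
  obtain ⟨d0, hd0⟩ := mk_surjective C (d : CoordRing C)
  have hxd : aeval x d0 = ψ d := by rw [hx, hd0]
  have hdne : ψ d ≠ 0 := by
    rw [Ne, map_eq_zero_iff ψ hψ]
    exact nonZeroDivisors.ne_zero d.2
  let v : κ → κ → MvPolynomial κ K := fun b k => if hb : b ∈ β then w ⟨b, hb⟩ k else 0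
  have hv : ∀ b (hb : b ∈ β) k, aeval x (v b k) = ψ d * D ⟨b, hb⟩ (x k) := fun b hb k => by
    simp only [v, dif_pos hb, hw]
  have hvf : ∀ b (hb : b ∈ β) f, aeval x (fieldApply (v b) f) = ψ d * D ⟨b, hb⟩ (aeval x f) := by
    intro b hb f
    rw [derivation_aeval, fieldApply, map_sum, Finset.mul_sum]
    refine Finset.sum_congr rfl fun k _ => ?_
    rw [map_mul, hv b hb, mul_assoc]
  refine ⟨β, d0, v, ?_, (hindep _).1 hβ, ?_, ?_, ?_, ?_⟩
  · rw [← hx0, hxd]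
    exact hdne
  · intro γ hγ
    have h1 := AlgebraicIndependent.lift_cardinalMk_le_trdeg ((hindep _).2 hγ)
    rw [← htb.lift_cardinalMk_eq_trdeg] at h1
    simpa using h1
  · intro b hb b' hb'
    rw [← hx0, map_sub, hv b hb, hD ⟨b, hb⟩ ⟨b', hb'⟩]
    by_cases h : b = b'
    · simp [h, hxd]
    · simp [h]
  · intro b hb f hf
    rw [← hx0] at hf ⊢
    rw [hvf b hb, hf, map_zero, mul_zero]
  · intro f g hg h
    rw [← hx0] at hg
    -- By the quotient rule the hypothesis says that `f / g` is killed by all partial derivatives.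
    -- It is then algebraic over `K`, hence a constant.
    have hρ : ∀ b, D b (aeval x f / aeval x g) = 0 := by
      rintro ⟨b, hb⟩
      have h1 := (hx0 _).2 (h b hb)
      rw [map_sub, map_mul, map_mul, hvf b hb, hvf b hb] at h1
      have h2 : ψ d * (aeval x g * D ⟨b, hb⟩ (aeval x f) - aeval x f * D ⟨b, hb⟩ (aeval x g)) =
          0 := by
        rw [← h1]; ring
      rw [Derivation.leibniz_div]
      simp only [smul_eq_mul, (mul_eq_zero.1 h2).resolve_left hdne, mul_zero]
    obtain ⟨t, ht⟩ := exists_algebraMap_eq_of_isAlgebraic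
      (isAlgebraic_of_forall_derivation_eq_zero htb D hD hρ)
    refine ⟨t, ?_⟩
    rw [← hx0, map_sub, map_mul, aeval_C, ht, div_mul_cancel₀ _ hg, sub_self]

end TangentFields

end GrassmannSecants
end

noncomputable section
namespace GrassmannSecants

/-! ### The trisecant lemma at the generic point. -/

section TrisecantLemma

open MvPolynomial CoordRing

/-- A set of vectors like the affine cone over an irreducible nondegenerate variety. -/
structure IsNondegenerateCone {K κ : Type*} [Field K] [Fintype κ] (C : Set (κ → K)) : Prop where
  isPrime : (vanishingIdeal K C).IsPrime
  smul_mem : ∀ (t : K), ∀ x ∈ C, t • x ∈ C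
  nondegenerate : ∀ l : κ → K, (∀ x ∈ C, ∑ k, l k * x k = 0) → l = 0

/-- The tuples of elements of `C`, as vectors with two indices. -/
def tupleSet {K κ : Type*} (C : Set (κ → K)) (ι : Type*) : Set (ι × κ → K) :=
  {x | ∀ i, (fun k => x (i, k)) ∈ C}

/-- The homomorphism of the coordinate ring defined by a point at which all vanishing
polynomials vanish. -/
def CoordRing.lift {K σ F : Type*} [Field K] [CommRing F] [Algebra K F] (W : Set (σ → K))
    (z : σ → F) (hz : ∀ f ∈ vanishingIdeal K W, aeval z f = 0) : CoordRing W →ₐ[K] F :=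
  Ideal.Quotient.liftₐ _ (aeval z) hz

@[simp] theorem CoordRing.lift_coord {K σ F : Type*} [Field K] [CommRing F] [Algebra K F]
    (W : Set (σ → K)) (z : σ → F) (hz : ∀ f ∈ vanishingIdeal K W, aeval z f = 0) (i : σ) :
    CoordRing.lift W z hz (coord W i) = z i :=
  aeval_X z i

/-- The Euler vector field is tangent to cones. -/
theorem isTangentField_X {K κ : Type*} [Field K] [Infinite K] [Fintype κ] {C : Set (κ → K)}
    (hC : ∀ (t : K), ∀ x ∈ C, t • x ∈ C) : IsTangentField C X := by
  intro f hf x hx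
  let w : κ → Polynomial K := fun k => Polynomial.C (x k) * Polynomial.X
  have hw : ∀ (t : K) (g : MvPolynomial κ K), Polynomial.eval t (aeval w g) = aeval (t • x) g := by
    intro t g
    rw [← Polynomial.coe_aeval_eq_eval, comp_aeval_apply]
    congr 2
    ext k
    rw [map_mul, Polynomial.aeval_C, Polynomial.aeval_X, Pi.smul_apply, smul_eq_mul]
    exact mul_comm _ _
  -- `f` vanishes on the whole line through `x`; the derivative of this restriction at `t = 1` is
  -- the Euler field applied to `f`.
  have hq : aeval w f = 0 := Polynomial.funext fun t => by
    rw [hw, hf _ (hC t x hx), Polynomial.eval_zero]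
  have h := congrArg (Polynomial.eval 1) (derivation_aeval (Polynomial.derivative' (R := K)) w f)
  rw [hq, map_zero, Polynomial.eval_finsetSum, Polynomial.eval_zero] at h
  rw [fieldApply, map_sum, h]
  refine Finset.sum_congr rfl fun k _ => ?_
  rw [Polynomial.eval_mul, hw, map_mul, aeval_X, one_smul]
  simp [Polynomial.derivative', w]

/-- A tangent field of `C` acts on regular functions of tuples through one of the factors. -/
theorem exists_derivation_tupleSet {K κ ι : Type*} [Field K] [Fintype κ] [Fintype ι]
    [DecidableEq ι] {C : Set (κ → K)} {v : κ → MvPolynomial κ K} (hv : IsTangentField C v)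
    (i : ι) : ∃ D : Derivation K (CoordRing (tupleSet C ι)) (CoordRing (tupleSet C ι)),
      ∀ j k, D (coord _ (j, k)) = if j = i then mk _ (rename (Prod.mk i) (v k)) else 0 := by
  classical
  let c : ι × κ → MvPolynomial (ι × κ) K := fun jk =>
    if jk.1 = i then rename (Prod.mk i) (v jk.2) else 0
  let D : Derivation K (MvPolynomial (ι × κ) K) (MvPolynomial (ι × κ) K) := mkDerivation K c
  have hD : ∀ f, mk (tupleSet C ι) f = 0 → mk (tupleSet C ι) (D f) = 0 := by
    intro f hf
    rw [mk_eq_zero_iff] at hf ⊢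
    intro y hy
    -- All factors other than the `i`-th are frozen at `y`, which reduces tangency on the product to
    -- tangency of `v` to `C`.
    let z : ι × κ → MvPolynomial κ K := fun jk =>
      if jk.1 = i then X jk.2 else MvPolynomial.C (y jk)
    have hz : ∀ g : MvPolynomial (ι × κ) K, aeval (fun k => y (i, k)) (aeval z g : MvPolynomial κ K) = aeval y g := by
      intro g
      have : (aeval (fun k => y (i, k)) : MvPolynomial κ K →ₐ[K] K).comp (aeval z) = aeval y := by
        apply algHom_ext
        rintro ⟨j, k⟩
        by_cases hj : j = i
        · subst hj; simp [z]
        · simp [z, hj]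
      exact congrArg (fun φ => φ g) this
    have hzf : aeval z f ∈ vanishingIdeal K C := by
      intro u hu
      have : aeval u (aeval z f) = aeval (fun jk : ι × κ => if jk.1 = i then u jk.2 else y jk) f := by
        have : (aeval u).comp (aeval z) =
            aeval (fun jk : ι × κ => if jk.1 = i then u jk.2 else y jk) := by
          apply algHom_ext
          rintro ⟨j, k⟩
          by_cases hj : j = i
          · simp [z, hj]
          · simp [z, hj]
        exact congrArg (fun φ => φ f) this
      rw [this]
      apply hf
      intro j
      by_cases hj : j = i
      · simpa [hj] using hu
      · simpa [hj] using hy j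
    have hchain : ∀ k, pderiv k (aeval z f) = aeval z (pderiv (i, k) f) := by
      intro k
      rw [derivation_aeval, Finset.sum_eq_single (i, k)]
      · simp [z]
      · rintro ⟨j, l⟩ _ hne
        by_cases hj : j = i
        · have : l ≠ k := fun h => hne (by rw [hj, h])
          simp [z, hj, pderiv_X, Pi.single_eq_of_ne' this.symm]
        · simp [z, hj]
      · simp
    have h := hv _ hzf _ (hy i)
    rw [fieldApply, map_sum] at h
    have hDf : D f = ∑ jk, c jk * pderiv jk f := by
      have := derivation_aeval D X f
      simpa [D, mkDerivation_X] using this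
    rw [hDf, map_sum, Fintype.sum_prod_type, Finset.sum_eq_single i]
    · rw [← h]
      refine Finset.sum_congr rfl fun k _ => ?_
      rw [map_mul, map_mul, hchain, hz]
      simp only [c, if_true]
      rw [aeval_rename]
      rfl
    · intro j _ hj
      simp [c, hj]
    · simp
  refine ⟨Derivation.liftOfSurjective (f := mk (tupleSet C ι)) (mk_surjective _) hD,
    fun j k => ?_⟩
  rw [coord, Derivation.liftOfSurjective_apply]
  simp only [D, mkDerivation_X, c]
  split_ifs
  · rfl
  · simp

/-- The tangent spaces at two general points `x₀`, `x₁` of a cone are contained in the space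
spanned by `x₀` and the image of derivations at a further point `c • x₀ + x₁`. -/
theorem tangent_mem_sup {K κ F : Type*} [Field K] [Fintype κ] [Field F] [CharZero F] [Algebra K F]
    {C : Set (κ → K)} [Algebra (CoordRing (tupleSet C (Fin 2))) F]
    [IsScalarTower K (CoordRing (tupleSet C (Fin 2))) F]
    [FaithfulSMul (CoordRing (tupleSet C (Fin 2))) F]
    [Algebra.IsAlgebraic (CoordRing (tupleSet C (Fin 2))) F]
    [IsDomain (CoordRing (tupleSet C (Fin 2)))] {c : F} (hc : c ≠ 0)
    {x : Fin 2 → κ → F}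
    (hx : ∀ i k, x i k = algebraMap (CoordRing (tupleSet C (Fin 2))) F (coord _ (i, k)))
    {v : κ → MvPolynomial κ K} (hv : IsTangentField C v) (i : Fin 2) :
    (fun k => aeval (x i) (v k)) ∈
      LinearMap.range (derivationEval K fun k => c * x 0 k + x 1 k) ⊔ F ∙ x 0 := by
  obtain ⟨D, hD⟩ := exists_derivation_tupleSet hv i
  obtain ⟨D', hD'⟩ := exists_derivation_extending (F := F)
    ((Algebra.linearMap (CoordRing (tupleSet C (Fin 2))) F).compDer D)
  have hDx : ∀ j k, D' (x j k) = if j = i then aeval (x i) (v k) else 0 := by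
    intro j k
    rw [hx, hD']
    change algebraMap _ F (D _) = _
    rw [hD]
    split_ifs
    · have : aeval (x i) = ((IsScalarTower.toAlgHom K (CoordRing (tupleSet C (Fin 2))) F).comp
          (mk _)).comp (rename (Prod.mk i)) := by
        apply algHom_ext
        intro k
        simp [hx, coord]
      rw [this]
      rfl
    · simp
  have hE : (fun k => D' (c * x 0 k + x 1 k)) ∈
      LinearMap.range (derivationEval K fun k => c * x 0 k + x 1 k) := ⟨D', rfl⟩
  have hx0 : x 0 ∈ F ∙ x 0 := Submodule.mem_span_singleton_self _
  -- By Leibniz this vector is `c • D' (x 0) + D' (x 1)`. One of the two terms vanishes, as `D'`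
  -- moves only the factor `i`, and `c` is invertible.
  have hmem : (fun k => D' (c * x 0 k + x 1 k)) - D' c • x 0 ∈
      LinearMap.range (derivationEval K fun k => c * x 0 k + x 1 k) ⊔ F ∙ x 0 :=
    Submodule.sub_mem _ (Submodule.mem_sup_left hE)
      (Submodule.mem_sup_right (Submodule.smul_mem _ _ hx0))
  fin_cases i
  · refine (Submodule.smul_mem_iff _ hc).1 ?_
    convert hmem using 1
    ext k
    simp [hDx]
    ring
  · convert hmem using 1
    ext k
    simp [hDx]
    ring

end TrisecantLemma

end GrassmannSecants
end

noncomputable section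
namespace GrassmannSecants

section TrisecantLemma

open MvPolynomial CoordRing

/-- If the secant variety of a cone has a further point on the generic secant line, then
the tangent spaces at two general points satisfy a determinantal condition. -/
theorem det_tangent_mem_vanishingIdeal {K κ F : Type*} [Field K] [Fintype κ] [DecidableEq κ]
    [Field F] [CharZero F] [Infinite K]
    [Algebra K F] {C : Set (κ → K)} (hC : IsNondegenerateCone C)
    [Algebra (CoordRing (tupleSet C (Fin 2))) F]
    [IsScalarTower K (CoordRing (tupleSet C (Fin 2))) F]
    [FaithfulSMul (CoordRing (tupleSet C (Fin 2))) F]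
    [Algebra.IsAlgebraic (CoordRing (tupleSet C (Fin 2))) F]
    [IsDomain (CoordRing (tupleSet C (Fin 2)))] {c : F} (hc : c ≠ 0)
    {x : Fin 2 → κ → F}
    (hx : ∀ i k, x i k = algebraMap (CoordRing (tupleSet C (Fin 2))) F (coord _ (i, k)))
    (hz : ∀ f ∈ vanishingIdeal K C, aeval (fun k => c * x 0 k + x 1 k) f = 0)
    {β : Finset κ}
    (hβ : ∀ γ : Finset κ, AlgebraicIndepOn K (coord C) (γ : Set κ) → γ.card ≤ β.card)
    {v : κ → κ → MvPolynomial κ K} (hv : ∀ b ∈ β, IsTangentField C (v b))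
    {u : κ → MvPolynomial κ K} (hu : IsTangentField C u) (e : β ⊕ Fin 2 → κ) :
    (Matrix.of fun (i j : β ⊕ Fin 2) => Sum.elim (fun b : β => rename (Prod.mk (0 : Fin 2)) (v b (e j)))
      ![X (1, e j), rename (Prod.mk (1 : Fin 2)) (u (e j))] i).det ∈
      vanishingIdeal K (tupleSet C (Fin 2)) := by
  let W := LinearMap.range (derivationEval K fun k => c * x 0 k + x 1 k) ⊔ F ∙ x 0
  have hW : Module.finrank F W ≤ β.card + 1 := by
    refine (Submodule.finrank_add_le_finrank_add_finrank _ _).trans (add_le_add ?_ ?_)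
    -- The third point is a point of `C` over `F`, so algebraically independent coordinates of it
    -- come from algebraically independent coordinates of `C`.
    · refine finrank_range_derivationEval_le _ fun γ hγ => hβ γ ?_
      refine AlgebraicIndependent.of_comp (CoordRing.lift C _ hz) ?_
      convert hγ using 1
      ext i
      simp
    · exact finrank_span_le_card (R := F) ({x 0} : Set (κ → F)) |>.trans (by simp)
  let r : β ⊕ Fin 2 → κ → F := Sum.elim (fun b k => aeval (x 0) (v b k))
    ![x 1, fun k => aeval (x 1) (u k)]
  have hr : ∀ i, r i ∈ W := by
    rintro (b | i)
    · exact tangent_mem_sup hc hx (hv b b.2) 0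
    · fin_cases i
      -- The Euler field contributes the vector `x 1` itself.
      · have := tangent_mem_sup hc hx (isTangentField_X hC.smul_mem) 1
        simp only [aeval_X] at this
        exact this
      · exact tangent_mem_sup hc hx hu 1
  -- There are `β.card + 2` vectors in a space of dimension at most `β.card + 1`.
  have hdep : ¬ LinearIndependent F r := by
    intro hli
    have hli' : LinearIndependent F fun i => (⟨r i, hr i⟩ : W) :=
      LinearIndependent.of_comp W.subtype hli
    have := hli'.fintype_card_le_finrank
    simp only [Fintype.card_sum, Fintype.card_coe, Fintype.card_fin] at this
    omega
  rw [Fintype.not_linearIndependent_iff] at hdep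
  obtain ⟨g, hg, i, hi⟩ := hdep
  let φ : MvPolynomial (Fin 2 × κ) K →ₐ[K] F :=
    (IsScalarTower.toAlgHom K (CoordRing (tupleSet C (Fin 2))) F).comp (mk _)
  have hφX : ∀ i k, φ (X (i, k)) = x i k := fun i k => (hx i k).symm
  have hφ : ∀ i p, φ (rename (Prod.mk i) p) = aeval (x i) p := by
    intro i p
    have : φ.comp (rename (Prod.mk i)) = aeval (x i) := by
      apply algHom_ext
      intro k
      simp [hφX]
    exact congrArg (fun f => f p) this
  rw [← mk_eq_zero_iff]
  apply FaithfulSMul.algebraMap_injective (CoordRing (tupleSet C (Fin 2))) F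
  rw [map_zero]
  change φ (Matrix.det _) = 0
  rw [AlgHom.map_det]
  refine Matrix.exists_vecMul_eq_zero_iff.1 ⟨g, fun h => hi (congrFun h i), ?_⟩
  ext j
  have := congrFun hg (e j)
  rw [Finset.sum_apply] at this
  rw [Pi.zero_apply, ← Pi.zero_apply (M := fun _ : κ => F) (e j), ← this]
  refine Finset.sum_congr rfl fun i _ => ?_
  rw [Pi.smul_apply, smul_eq_mul]
  congr 1
  rcases i with b | i
  · simp [r, hφ]
  · fin_cases i <;> simp [r, hφ, hφX]

/-- The generic secant line of a nondegenerate cone of codimension at least two contains no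
further points of the cone. -/
theorem not_generic_trisecant {K κ F : Type*} [Field K] [IsAlgClosed K] [CharZero K]
    [Fintype κ] [Field F]
    [Algebra K F] {C : Set (κ → K)} (hC : IsNondegenerateCone C)
    [Algebra (CoordRing (tupleSet C (Fin 2))) F]
    [IsScalarTower K (CoordRing (tupleSet C (Fin 2))) F]
    [FaithfulSMul (CoordRing (tupleSet C (Fin 2))) F]
    [Algebra.IsAlgebraic (CoordRing (tupleSet C (Fin 2))) F]
    [IsDomain (CoordRing (tupleSet C (Fin 2)))]
    (htr : ∀ γ : Finset κ, AlgebraicIndepOn K (coord C) (γ : Set κ) → γ.card + 2 ≤ Fintype.card κ)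
    {c : F} (hc : c ≠ 0) {x : Fin 2 → κ → F}
    (hx : ∀ i k, x i k = algebraMap (CoordRing (tupleSet C (Fin 2))) F (coord _ (i, k)))
    (hz : ∀ f ∈ vanishingIdeal K C, aeval (fun k => c * x 0 k + x 1 k) f = 0) : False := by
  classical
  have : CharZero F := charZero_of_injective_algebraMap (algebraMap K F).injective
  obtain ⟨β, d, v, hd, hβ, hmax, hvβ, htan, hconst⟩ := exists_tangent_fields C hC.isPrime
  have hcard : 2 ≤ (βᶜ).card := by
    have := htr β hβ
    rw [Finset.card_compl]
    omega
  obtain ⟨k₁, hk₁, k₂, hk₂, hne⟩ := Finset.one_lt_card.1 hcard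
  rw [Finset.mem_compl] at hk₁ hk₂
  -- At a point with `d ≠ 0` the fields `v b` are independent; their values at `a` play the role of
  -- the tangent space there.
  obtain ⟨a, haC, had⟩ : ∃ a ∈ C, aeval a d ≠ 0 := by
    by_contra! h
    exact hd h
  let D := aeval a d
  -- For `k' ∉ β`, these are the coefficients of a linear form killing all `v b (a)`. It is
  -- supported on `β` and `k'`, with coefficient `D` at `k'`, so `l k₁` and `l k₂` are independent.
  let l : κ → κ → K := fun k' k =>
    (if k = k' then D else 0) - if k ∈ β then aeval a (v k k') else 0
  let lp : κ → MvPolynomial κ K := fun k' => ∑ k, MvPolynomial.C (l k' k) * X k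
  have hlp : ∀ k' y, aeval y (lp k') = ∑ k, l k' k * y k := fun k' y => by
    simp [lp]
  have hflp : ∀ k' (w : κ → MvPolynomial κ K) y,
      aeval y (fieldApply w (lp k')) = ∑ k, l k' k * aeval y (w k) := fun k' w y => by
    have : ∀ k, pderiv k (lp k') = MvPolynomial.C (l k' k) := fun k => by
      simp only [lp, map_sum, Derivation.leibniz, pderiv_C, pderiv_X, smul_eq_mul]
      rw [Finset.sum_eq_single k]
      · simp
      · intro j _ hj
        simp [Pi.single_eq_of_ne hj]
      · simp
    simp [fieldApply, this, mul_comm]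
  have hvv : ∀ b ∈ β, ∀ b' ∈ β, aeval a (v b b') = if b = b' then D else 0 := by
    intro b hb b' hb'
    have := hvβ b hb b' hb' a haC
    rw [map_sub, sub_eq_zero] at this
    rw [this]
    split_ifs <;> simp [D]
  have hlv : ∀ k', ∀ b ∈ β, ∑ k, l k' k * aeval a (v b k) = 0 := by
    intro k' b hb
    simp only [l, sub_mul, Finset.sum_sub_distrib, ite_mul, zero_mul, Finset.sum_ite_eq',
      Finset.mem_univ, if_true]
    rw [← Finset.sum_filter, Finset.filter_univ_mem, Finset.sum_eq_single b]
    · rw [hvv b hb b hb, if_pos rfl]; ring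
    · intro j hj hjb
      rw [hvv b hb j hj, if_neg hjb.symm, mul_zero]
    · exact fun h => absurd hb h
  -- The numerator of the derivative of `l k₁ / l k₂` along `v b₀` vanishes on `C`.
  have key : ∀ b₀ ∈ β, ∀ y ∈ C, (∑ k, l k₂ k * y k) * (∑ k, l k₁ k * aeval y (v b₀ k)) -
      (∑ k, l k₁ k * y k) * (∑ k, l k₂ k * aeval y (v b₀ k)) = 0 := by
    intro b₀ hb₀ y hy
    let e : β ⊕ Fin 2 → κ := Sum.elim Subtype.val ![k₁, k₂]
    have hdet := det_tangent_mem_vanishingIdeal hC hc hx hz hmax htan (htan b₀ hb₀) e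
      (fun ik => ![a, y] ik.1 ik.2) (by
        intro i
        fin_cases i
        · exact haC
        · exact hy)
    rw [AlgHom.map_det] at hdet
    obtain ⟨g, hg0, hg⟩ := Matrix.exists_vecMul_eq_zero_iff.2 hdet
    have hcomb : ∀ j, ∑ b : β, g (Sum.inl b) * aeval a (v b (e j)) + (g (Sum.inr 0) * y (e j) +
        g (Sum.inr 1) * aeval y (v b₀ (e j))) = 0 := by
      intro j
      have := congrFun hg j
      simp only [Matrix.vecMul, dotProduct, Fintype.sum_sum_type, Fin.sum_univ_two] at this
      rw [Pi.zero_apply] at this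
      rw [← this]
      simp only [AlgHom.mapMatrix_apply, Matrix.map_apply, Matrix.of_apply, Sum.elim_inl,
        Sum.elim_inr, Matrix.cons_val_zero, Matrix.cons_val_one, aeval_rename, aeval_X]
      rfl
    -- Applying `l k'` to the row relation removes the tangent vectors at `a`. Only the columns in
    -- `β` and `k₁`, `k₂` are available, which suffices because of the support of `l k'`.
    have hrel : ∀ k' ∈ ({k₁, k₂} : Finset κ), g (Sum.inr 0) * (∑ k, l k' k * y k) +
        g (Sum.inr 1) * (∑ k, l k' k * aeval y (v b₀ k)) = 0 := by
      intro k' hk'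
      have h1 : ∑ k, l k' k * (∑ b : β, g (Sum.inl b) * aeval a (v b k) + (g (Sum.inr 0) * y k +
          g (Sum.inr 1) * aeval y (v b₀ k))) = 0 := by
        refine Finset.sum_eq_zero fun k _ => ?_
        by_cases hk : k ∈ β
        · have := hcomb (Sum.inl ⟨k, hk⟩)
          simp only [e, Sum.elim_inl] at this
          rw [this, mul_zero]
        · by_cases hkk : k = k'
          · rw [Finset.mem_insert, Finset.mem_singleton] at hk'
            have : ∃ j, e j = k := by
              rcases hk' with h | h
              · exact ⟨Sum.inr 0, by rw [hkk, h]; rfl⟩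
              · exact ⟨Sum.inr 1, by rw [hkk, h]; rfl⟩
            obtain ⟨j, rfl⟩ := this
            rw [hcomb j, mul_zero]
          · simp [l, hk, hkk]
      simp only [mul_add, Finset.sum_add_distrib, Finset.mul_sum] at h1
      rw [Finset.sum_comm] at h1
      have h2 : ∑ b : β, ∑ k, l k' k * (g (Sum.inl b) * aeval a (v b k)) = 0 := by
        refine Finset.sum_eq_zero fun b _ => ?_
        have := hlv k' b b.2
        rw [← mul_zero (g (Sum.inl b)), ← this, Finset.mul_sum]
        exact Finset.sum_congr rfl fun k _ => by ring
      rw [h2, zero_add] at h1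
      rw [← h1, Finset.mul_sum, Finset.mul_sum]
      congr 1 <;> exact Finset.sum_congr rfl fun k _ => by ring
    have hr1 := hrel k₁ (by simp)
    have hr2 := hrel k₂ (by simp)
    by_cases h0 : g (Sum.inr 0) = 0
    · by_cases h1 : g (Sum.inr 1) = 0
      -- Without the last two rows the relation is trivial: on the columns in `β` the tangent
      -- vectors at `a` form `D` times the identity.
      · exfalso
        apply hg0
        ext i
        rcases i with b | i
        · have := hcomb (Sum.inl b)
          simp only [e, Sum.elim_inl, h0, h1, zero_mul, add_zero] at this
          rw [Finset.sum_eq_single b] at this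
          · rw [hvv b b.2 b b.2, if_pos rfl] at this
            exact (mul_eq_zero.1 this).resolve_right had
          · intro b' _ hb'
            rw [hvv b' b'.2 b b.2, if_neg (fun h => hb' (Subtype.ext h)), mul_zero]
          · simp
        · fin_cases i
          · exact h0
          · exact h1
      · apply mul_left_cancel₀ h1
        linear_combination (∑ k, l k₂ k * y k) * hr1 - (∑ k, l k₁ k * y k) * hr2
    · apply mul_left_cancel₀ h0
      linear_combination (∑ k, l k₁ k * aeval y (v b₀ k)) * hr2 -
        (∑ k, l k₂ k * aeval y (v b₀ k)) * hr1
  have hl : ∀ k', k' ∉ β → l k' k' = D := fun k' hk' => by simp [l, hk']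
  -- The ratio of the two forms is a constant `t` on `C`, so `l k₁ - t • l k₂` vanishes on `C`,
  -- although its coefficient at `k₁` is `D ≠ 0`.
  obtain ⟨t, ht⟩ := hconst (lp k₁) (lp k₂) (fun h => by
      have := hC.nondegenerate (l k₂) fun y hy => by rw [← hlp]; exact h y hy
      have h2 := congrFun this k₂
      rw [hl k₂ hk₂] at h2
      exact had h2) (fun b hb y hy => by
      rw [map_sub, map_mul, map_mul, hlp, hlp, hflp, hflp]
      exact key b hb y hy)
  have := hC.nondegenerate (fun k => l k₁ k - t * l k₂ k) fun y hy => by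
    have := ht y hy
    rw [map_sub, map_mul, hlp, hlp, aeval_C, Finset.mul_sum, ← Finset.sum_sub_distrib] at this
    rw [← this]
    exact Finset.sum_congr rfl fun k _ => by
      simp only [Algebra.algebraMap_self, RingHom.id_apply]; ring
  have h1 := congrFun this k₁
  simp only [hl k₁ hk₁, Pi.zero_apply] at h1
  have h2 : l k₂ k₁ = 0 := by simp [l, hk₁, hne]
  rw [h2, mul_zero, sub_zero] at h1
  exact had h1

end TrisecantLemma

end GrassmannSecants
end

noncomputable section
namespace GrassmannSecants

/-! ### Irreducibility of products and general pairs of points. -/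

section GeneralTuples

open MvPolynomial CoordRing

universe u

/-- The set of points at which all polynomials vanishing on `C` vanish. -/
def zariskiHull {K κ : Type*} [Field K] (C : Set (κ → K)) : Set (κ → K) :=
  {x | ∀ f ∈ vanishingIdeal K C, aeval x f = 0}

theorem subset_zariskiHull {K κ : Type*} [Field K] (C : Set (κ → K)) : C ⊆ zariskiHull C :=
  fun x hx _ hf => hf x hx

theorem aeval_aeval_eq {K σ τ F : Type*} [CommRing K] [CommRing F] [Algebra K F]
    {z : σ → MvPolynomial τ K} {u : τ → F} {w : σ → F} (h : ∀ i, aeval u (z i) = w i)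
    (f : MvPolynomial σ K) : aeval u (aeval z f) = aeval w f := by
  rw [comp_aeval_apply, funext h]

theorem smul_mem_zariskiHull {K κ : Type*} [Field K] {C : Set (κ → K)}
    (hC : ∀ (t : K), ∀ x ∈ C, t • x ∈ C) (t : K) {x : κ → K} (hx : x ∈ zariskiHull C) :
    t • x ∈ zariskiHull C := by
  intro f hf
  have h : ∀ y : κ → K, aeval y (aeval (fun k => MvPolynomial.C t * X k) f : MvPolynomial κ K) =
      aeval (t • y) f := fun y => aeval_aeval_eq (fun k => by
    rw [map_mul, aeval_C, aeval_X]
    rfl) f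
  rw [← h]
  refine hx _ fun y hy => ?_
  rw [h]
  exact hf _ (hC t y hy)

theorem notMem_vanishingIdeal {K κ : Type*} [Field K] {C : Set (κ → K)} {f : MvPolynomial κ K} :
    f ∉ vanishingIdeal K C ↔ ∃ x ∈ C, aeval x f ≠ 0 := by
  rw [mem_vanishingIdeal_iff]
  push Not
  rfl

/-- Restriction of a polynomial in several vectors to one of them. -/
def sliceAt {K κ ι : Type*} [Field K] [DecidableEq ι] (i : ι) (y : ι × κ → K) :
    MvPolynomial (ι × κ) K →ₐ[K] MvPolynomial κ K :=
  aeval fun jk => if jk.1 = i then X jk.2 else MvPolynomial.C (y jk)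

theorem aeval_sliceAt {K κ ι : Type*} [Field K] [DecidableEq ι] (i : ι) (y : ι × κ → K)
    (u : κ → K) (f : MvPolynomial (ι × κ) K) :
    aeval u (sliceAt i y f) = aeval (fun jk : ι × κ => if jk.1 = i then u jk.2 else y jk) f := by
  refine aeval_aeval_eq (fun jk => ?_) f
  split_ifs <;> simp

theorem ite_mem_tupleSet {K κ ι : Type*} [DecidableEq ι] {C : Set (κ → K)} {i : ι}
    {y : ι × κ → K} (hy : y ∈ tupleSet C ι) {u : κ → K} (hu : u ∈ C) :
    (fun jk : ι × κ => if jk.1 = i then u jk.2 else y jk) ∈ tupleSet C ι := by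
  intro j
  by_cases hj : j = i
  · simpa [hj] using hu
  · simpa [hj] using hy j

/-- Products of irreducible sets are irreducible. -/
theorem isPrime_vanishingIdeal_tupleSet {K κ ι : Type*} [Field K] [Finite ι] {C : Set (κ → K)}
    (hC : (vanishingIdeal K C).IsPrime) : (vanishingIdeal K (tupleSet C ι)).IsPrime := by
  classical
  cases nonempty_fintype ι
  obtain ⟨u₀, hu₀, -⟩ := notMem_vanishingIdeal.1 ((Ideal.ne_top_iff_one _).1 hC.ne_top)
  have hbase : (fun jk => u₀ jk.2 : ι × κ → K) ∈ tupleSet C ι := fun _ => hu₀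
  -- Induction on the set `S` of factors that are free to move, the others being fixed at `x`.
  have key : ∀ (S : Finset ι) (x : ι × κ → K), x ∈ tupleSet C ι →
      ∀ f g : MvPolynomial (ι × κ) K,
      (∀ y ∈ tupleSet C ι, (∀ jk : ι × κ, jk.1 ∉ S → y jk = x jk) →
        aeval y f = 0 ∨ aeval y g = 0) →
      (∀ y ∈ tupleSet C ι, (∀ jk : ι × κ, jk.1 ∉ S → y jk = x jk) → aeval y f = 0) ∨
      ∀ y ∈ tupleSet C ι, (∀ jk : ι × κ, jk.1 ∉ S → y jk = x jk) → aeval y g = 0 := by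
    intro S
    induction S using Finset.induction_on with
    | empty =>
      intro x hx f g h
      have heq : ∀ y : ι × κ → K, (∀ jk : ι × κ, jk.1 ∉ (∅ : Finset ι) → y jk = x jk) → y = x :=
        fun y hy => funext fun jk => hy jk (by simp)
      rcases h x hx fun _ _ => rfl with h0 | h0
      · exact Or.inl fun y _ hyx => by rw [heq y hyx, h0]
      · exact Or.inr fun y _ hyx => by rw [heq y hyx, h0]
    | insert i S hi ih =>
      intro x hx f g h
      by_contra! hcon
      obtain ⟨⟨y₁, hy₁, hyx₁, hf⟩, ⟨y₂, hy₂, hyx₂, hg⟩⟩ := hcon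
      have hself : ∀ y : ι × κ → K,
          (fun jk : ι × κ => if jk.1 = i then y (i, jk.2) else y jk) = y := fun y => by
        ext ⟨j, k⟩
        by_cases hj : j = i <;> simp [hj]
      have hf' : sliceAt i y₁ f ∉ vanishingIdeal K C := notMem_vanishingIdeal.2
        ⟨_, hy₁ i, by rwa [aeval_sliceAt, hself]⟩
      have hg' : sliceAt i y₂ g ∉ vanishingIdeal K C := notMem_vanishingIdeal.2
        ⟨_, hy₂ i, by rwa [aeval_sliceAt, hself]⟩
      -- By irreducibility of one factor, some `u` keeps both slices nonzero. Fixing the factor `i`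
      -- at `u` contradicts the induction hypothesis.
      obtain ⟨u, hu, hfg⟩ := notMem_vanishingIdeal.1
        (fun hmem => (hC.mem_or_mem hmem).elim hf' hg')
      rw [map_mul, aeval_sliceAt, aeval_sliceAt] at hfg
      have hagree : ∀ y : ι × κ → K, (∀ jk : ι × κ, jk.1 ∉ insert i S → y jk = x jk) →
          ∀ jk : ι × κ, jk.1 ∉ S → (if jk.1 = i then u jk.2 else y jk) =
            if jk.1 = i then u jk.2 else x jk := by
        intro y hy jk hjk
        by_cases hj : jk.1 = i
        · simp [hj]
        · simpa [hj] using hy jk (by simp [hj, hjk])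
      rcases ih _ (ite_mem_tupleSet hx hu (i := i)) f g (fun y hy hyx => by
        refine h y hy fun jk hjk => ?_
        rw [Finset.mem_insert, not_or] at hjk
        simpa [hjk.1] using hyx jk hjk.2) with h' | h'
      · exact left_ne_zero_of_mul hfg
          (h' _ (ite_mem_tupleSet hy₁ hu) (hagree y₁ hyx₁))
      · exact right_ne_zero_of_mul hfg
          (h' _ (ite_mem_tupleSet hy₂ hu) (hagree y₂ hyx₂))
  refine ⟨?_, fun {f g} hfg => ?_⟩
  · rw [Ideal.ne_top_iff_one, notMem_vanishingIdeal]
    exact ⟨_, hbase, by simp⟩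
  · rcases key Finset.univ _ hbase f g (fun y hy _ => by
      have := hfg y hy
      rwa [map_mul, mul_eq_zero] at this) with h | h
    · exact Or.inl fun y hy => h y hy (by simp)
    · exact Or.inr fun y hy => h y hy (by simp)

/-- The general secant line of a nondegenerate cone of codimension at least two contains no
further points of the cone. -/
theorem exists_general_pairs {K : Type u} [Field K] [IsAlgClosed K] [CharZero K] {κ : Type}
    [Fintype κ] {C : Set (κ → K)} (hC : IsNondegenerateCone C) {N : ℕ}
    (htr : Algebra.trdeg K (CoordRing C) ≤ N) (hN : N + 2 ≤ Fintype.card κ) :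
    ∃ a ∉ vanishingIdeal K (tupleSet C (Fin 2)), ∀ x ∈ tupleSet C (Fin 2), aeval x a ≠ 0 →
      ∀ c : Fin 2 → K, (∀ i, c i ≠ 0) → (fun k => ∑ i, c i * x (i, k)) ∉ zariskiHull C := by
  have hprime := isPrime_vanishingIdeal_tupleSet (ι := Fin 2) hC.isPrime
  -- On a cone the coefficient of the second point can be scaled to `1`, which leaves the single
  -- unknown `c` in `c x₀ + x₁`.
  let T : MvPolynomial κ K →ₐ[K] MvPolynomial ((Fin 2 × κ) ⊕ Unit) K :=
    aeval fun k => X (Sum.inr ()) * X (Sum.inl (0, k)) + X (Sum.inl (1, k))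
  rcases elimination_alternative (τ := Unit) (tupleSet C (Fin 2)) hprime
    (T '' vanishingIdeal K C) (X (Sum.inr ())) with ⟨a, ha, h⟩ | ⟨-, F, _, _, _, _, _, _, c, hc, hg⟩
  · refine ⟨a, ha, fun x hx hxa c hc hmem => ?_⟩
    have := h x hx hxa (fun _ => c 0 / c 1) (by
      rintro _ ⟨f, hf, rfl⟩
      have := smul_mem_zariskiHull hC.smul_mem (c 1)⁻¹ hmem f hf
      rw [← this]
      refine aeval_aeval_eq (fun k => ?_) f
      have := hc 1
      simp [Fin.sum_univ_two]
      field_simp)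
    simp [hc 0, hc 1] at this
  · exfalso
    have := isDomain hprime
    refine not_generic_trisecant hC (F := F) (c := c ())
      (x := fun i k => algebraMap _ F (coord _ (i, k))) ?_ ?_ (fun _ _ => rfl) ?_
    · intro γ hγ
      have h1 := AlgebraicIndependent.lift_cardinalMk_le_trdeg hγ
      have h2 : (γ.card : Cardinal.{u}) ≤ N := by
        refine le_trans ?_ htr
        simpa using h1
      have : γ.card ≤ N := by exact_mod_cast h2
      omega
    · simpa using hg
    · intro f hf
      have := hc _ ⟨f, hf, rfl⟩
      rw [← this]
      exact (aeval_aeval_eq (fun k => by simp) f).symm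

end GeneralTuples

end GrassmannSecants
end

noncomputable section
namespace GrassmannSecants

/-! ### General tuples of points, by projection from a point of the cone. -/

section GeneralTuples

open MvPolynomial CoordRing

universe u

/-- The coordinates of a linear map, as linear forms. -/
def linearForms {K κ κ' : Type*} [Field K] [Fintype κ] [DecidableEq κ]
    (L : (κ → K) →ₗ[K] κ' → K) (k' : κ') : MvPolynomial κ K :=
  ∑ k, MvPolynomial.C (L (Pi.single k 1) k') * X k

theorem eq_sum_smul_single {K κ : Type*} [Field K] [Fintype κ] [DecidableEq κ] (x : κ → K) :
    x = ∑ k, x k • (Pi.single k 1 : κ → K) := by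
  ext j
  simp [Finset.sum_apply, Pi.single_apply]

@[simp] theorem aeval_linearForms {K κ κ' : Type*} [Field K] [Fintype κ] [DecidableEq κ]
    (L : (κ → K) →ₗ[K] κ' → K) (k' : κ') (x : κ → K) :
    aeval x (linearForms L k') = L x k' := by
  conv_rhs => rw [eq_sum_smul_single x, map_sum]
  simp [linearForms, mul_comm]

theorem IsNondegenerateCone.image {K κ κ' : Type*} [Field K] [Fintype κ] [Fintype κ']
    {C : Set (κ → K)} (hC : IsNondegenerateCone C) {L : (κ → K) →ₗ[K] κ' → K}
    (hL : Function.Surjective L) : IsNondegenerateCone (L '' C) := by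
  classical
  have hcomp : ∀ x (f : MvPolynomial κ' K), aeval x (aeval (linearForms L) f : MvPolynomial κ K) =
      aeval (L x) f := fun x f => aeval_aeval_eq (fun k => aeval_linearForms L k x) f
  have hmem : ∀ f : MvPolynomial κ' K, f ∈ vanishingIdeal K (L '' C) ↔
      (aeval (linearForms L) f : MvPolynomial κ K) ∈ vanishingIdeal K C := fun f => by
    simp only [mem_vanishingIdeal_iff, Set.forall_mem_image, hcomp]
  refine ⟨⟨?_, fun {f g} hfg => ?_⟩, ?_, ?_⟩
  · rw [Ideal.ne_top_iff_one, hmem, map_one]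
    exact (Ideal.ne_top_iff_one _).1 hC.isPrime.ne_top
  · rw [hmem] at *
    rw [hmem]
    rw [map_mul] at hfg
    exact hC.isPrime.mem_or_mem hfg
  · rintro t _ ⟨x, hx, rfl⟩
    exact ⟨t • x, hC.smul_mem t x hx, map_smul L t x⟩
  · intro l hl
    have h0 := hC.nondegenerate (fun k => ∑ k', l k' * L (Pi.single k 1) k') fun x hx => by
      rw [← hl _ ⟨x, hx, rfl⟩]
      have : ∀ k', L x k' = ∑ k, L (Pi.single k 1) k' * x k := fun k' => by
        rw [← aeval_linearForms]
        simp [linearForms]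
      simp only [this, Finset.mul_sum, Finset.sum_mul]
      rw [Finset.sum_comm]
      exact Finset.sum_congr rfl fun _ _ => Finset.sum_congr rfl fun _ _ => by ring
    have hlin : ∀ x, ∑ k', l k' * L x k' = 0 := by
      intro x
      rw [eq_sum_smul_single x, map_sum]
      simp only [map_smul, Finset.sum_apply, Pi.smul_apply, smul_eq_mul, Finset.mul_sum]
      rw [Finset.sum_comm]
      refine Finset.sum_eq_zero fun k _ => ?_
      have := congrFun h0 k
      simp only [Pi.zero_apply] at this
      rw [← mul_zero (x k), ← this, Finset.mul_sum]
      exact Finset.sum_congr rfl fun _ _ => by ring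
    ext k'
    obtain ⟨x, hx⟩ := hL (Pi.single k' 1)
    have := hlin x
    rw [hx, Finset.sum_eq_single k'] at this
    · simpa using this
    · intro j _ hj
      simp [Pi.single_eq_of_ne hj]
    · simp

theorem map_mem_zariskiHull {K κ κ' : Type*} [Field K] [Fintype κ] {C : Set (κ → K)}
    (L : (κ → K) →ₗ[K] κ' → K) {x : κ → K} (hx : x ∈ zariskiHull C) :
    L x ∈ zariskiHull (L '' C) := by
  classical
  have hcomp : ∀ x (f : MvPolynomial κ' K), aeval x (aeval (linearForms L) f : MvPolynomial κ K) =
      aeval (L x) f := fun x f => aeval_aeval_eq (fun k => aeval_linearForms L k x) f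
  intro f hf
  rw [← hcomp]
  exact hx _ fun y hy => by rw [hcomp]; exact hf _ ⟨y, hy, rfl⟩

/-- Functions on the image pull back injectively. Projection thus keeps the bound `N` while the
ambient dimension drops by one, which is the count in the induction below. -/
theorem trdeg_coordRing_image_le {K : Type u} {κ κ' : Type} [Field K] [Fintype κ]
    (C : Set (κ → K)) (L : (κ → K) →ₗ[K] κ' → K) :
    Algebra.trdeg K (CoordRing (L '' C)) ≤ Algebra.trdeg K (CoordRing C) := by
  classical
  have hcomp : ∀ x (f : MvPolynomial κ' K), aeval x (aeval (linearForms L) f : MvPolynomial κ K) =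
      aeval (L x) f := fun x f => aeval_aeval_eq (fun k => aeval_linearForms L k x) f
  let z : κ' → CoordRing C := fun k => mk C (linearForms L k)
  have hz : ∀ f : MvPolynomial κ' K, aeval z f = mk C (aeval (linearForms L) f) := fun f =>
    (comp_aeval_apply (linearForms L) (mk C) f).symm
  have hmem : ∀ f : MvPolynomial κ' K, f ∈ vanishingIdeal K (L '' C) ↔ aeval z f = 0 := fun f => by
    rw [hz, mk_eq_zero_iff]
    simp only [mem_vanishingIdeal_iff, Set.forall_mem_image, hcomp]
  refine trdeg_le_of_injective (CoordRing.lift _ z fun f hf => (hmem f).1 hf) ?_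
  rw [injective_iff_map_eq_zero]
  intro a ha
  obtain ⟨f, rfl⟩ := mk_surjective _ a
  exact mk_eq_zero_iff.2 ((hmem f).2 ha)

/-- The projection from a point. -/
theorem exists_projection {K κ : Type*} [Field K] [DecidableEq κ] (p : κ → K) {k₀ : κ}
    (hp : p k₀ ≠ 0) : ∃ L : (κ → K) →ₗ[K] {k // k ≠ k₀} → K, Function.Surjective L ∧ L p = 0 := by
  refine ⟨{ toFun := fun x k => x k - p k / p k₀ * x k₀, map_add' := ?_, map_smul' := ?_ }, ?_, ?_⟩
  · intro x y
    ext k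
    simp only [Pi.add_apply]
    ring
  · intro t x
    ext k
    simp only [Pi.smul_apply, smul_eq_mul, RingHom.id_apply]
    ring
  · intro y
    refine ⟨fun k => if hk : k ≠ k₀ then y ⟨k, hk⟩ else 0, ?_⟩
    ext k
    simp [k.2]
  · ext k
    simp [hp]

/-- The span of `s` general points of a nondegenerate cone of large codimension contains no point
of the cone that is a combination of all of them with nonzero coefficients. -/
theorem exists_general_tuples_of_two_le {K : Type u} [Field K] [IsAlgClosed K] [CharZero K]
    {s : ℕ} (hs : 2 ≤ s) : ∀ {κ : Type} [Fintype κ] {C : Set (κ → K)}, IsNondegenerateCone C →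
    ∀ {N : ℕ}, Algebra.trdeg K (CoordRing C) ≤ N → N + s ≤ Fintype.card κ →
    ∃ a ∉ vanishingIdeal K (tupleSet C (Fin s)), ∀ x ∈ tupleSet C (Fin s), aeval x a ≠ 0 →
      ∀ c : Fin s → K, (∀ i, c i ≠ 0) → (fun k => ∑ i, c i * x (i, k)) ∉ zariskiHull C := by
  induction s, hs using Nat.le_induction with
  | base =>
    intro κ _ C hC N htr hN
    exact exists_general_pairs hC htr hN
  | succ s hs ih =>
    intro κ _ C hC N htr hN
    classical
    have hprime : ∀ n, (vanishingIdeal K (tupleSet C (Fin n))).IsPrime := fun n =>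
      isPrime_vanishingIdeal_tupleSet hC.isPrime
    let T : MvPolynomial κ K →ₐ[K] MvPolynomial ((Fin (s + 1) × κ) ⊕ Fin (s + 1)) K :=
      aeval fun k => ∑ i, X (Sum.inr i) * X (Sum.inl (i, k))
    have hT : ∀ (x : Fin (s + 1) × κ → K) (c : Fin (s + 1) → K) f,
        aeval (Sum.elim x c) (T f) = aeval (fun k => ∑ i, c i * x (i, k)) f := fun x c f =>
      aeval_aeval_eq (fun k => by simp) f
    rcases elimination_alternative (τ := Fin (s + 1)) (tupleSet C (Fin (s + 1))) (hprime _)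
      (T '' vanishingIdeal K C) (∏ i, X (Sum.inr i)) with ⟨a, ha, h⟩ | ⟨⟨a, ha, h⟩, -⟩
    · refine ⟨a, ha, fun x hx hxa c hc hmem => ?_⟩
      have := h x hx hxa c (by
        rintro _ ⟨f, hf, rfl⟩
        rw [hT]
        exact hmem f hf)
      rw [map_prod] at this
      refine Finset.prod_ne_zero_iff.2 (fun i _ => ?_) this
      simpa using hc i
    -- Otherwise every sufficiently general tuple has a forbidden combination. Fixing the last point
    -- at a general `p` and projecting from `p` gives a forbidden combination of `s` general points
    -- of the projected cone.
    exfalso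
    have : Nonempty κ := Fintype.card_pos_iff.1 (by omega)
    obtain ⟨k₀⟩ := this
    have hk₀ : X (Fin.last s, k₀) ∉ vanishingIdeal K (tupleSet C (Fin (s + 1))) := by
      intro hmem
      have := hC.nondegenerate (Pi.single k₀ 1) fun x hx => by
        have := hmem (fun ik => x ik.2) (fun _ => hx)
        rw [Finset.sum_eq_single k₀]
        · simpa using this
        · intro j _ hj
          simp [Pi.single_eq_of_ne hj]
        · simp
      simpa using congrFun this k₀
    obtain ⟨y, hy, hay⟩ := notMem_vanishingIdeal.1
      (fun hmem => ((hprime (s + 1)).mem_or_mem hmem).elim ha hk₀)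
    rw [map_mul, aeval_X] at hay
    let p : κ → K := fun k => y (Fin.last s, k)
    obtain ⟨L, hLs, hLp⟩ := exists_projection p (right_ne_zero_of_mul hay)
    obtain ⟨a', ha', h'⟩ := ih (hC.image hLs) ((trdeg_coordRing_image_le C L).trans htr) (by
      rw [Fintype.card_subtype_compl]
      simp only [Fintype.card_unique]
      omega)
    let snoc : (Fin s × κ → K) → Fin (s + 1) × κ → K := fun x jk =>
      Fin.lastCases (motive := fun _ => K) (p jk.2) (fun i => x (i, jk.2)) jk.1
    have hsnoc_last : ∀ x k, snoc x (Fin.last s, k) = p k := fun x k => by simp [snoc]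
    have hsnoc_cast : ∀ x i k, snoc x (Fin.castSucc i, k) = x (i, k) := fun x i k => by
      simp [snoc]
    -- `A₁` says that the tuple completed by `p` is general, `A₂` that its projection is general.
    -- Both are nonzero on an irreducible set, so they hold at once.
    let A₁ : MvPolynomial (Fin s × κ) K := aeval (fun jk : Fin (s + 1) × κ =>
      Fin.lastCases (motive := fun _ => MvPolynomial (Fin s × κ) K) (MvPolynomial.C (p jk.2))
        (fun i => X (i, jk.2)) jk.1) a
    have hA₁ : ∀ x, aeval x A₁ = aeval (snoc x) a := fun x => aeval_aeval_eq (fun jk => by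
      obtain ⟨j, k⟩ := jk
      refine Fin.lastCases ?_ (fun i => ?_) j <;> simp [snoc]) a
    let A₂ : MvPolynomial (Fin s × κ) K :=
      aeval (fun ik : Fin s × {k // k ≠ k₀} => rename (Prod.mk ik.1) (linearForms L ik.2)) a'
    have hA₂ : ∀ x : Fin s × κ → K, aeval x A₂ =
        aeval (fun ik : Fin s × {k // k ≠ k₀} => L (fun k => x (ik.1, k)) ik.2) a' := fun x =>
      aeval_aeval_eq (fun ik => by
        rw [aeval_rename, ← aeval_linearForms]
        rfl) a'
    have h1 : A₁ ∉ vanishingIdeal K (tupleSet C (Fin s)) := by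
      refine notMem_vanishingIdeal.2 ⟨fun ik => y (Fin.castSucc ik.1, ik.2), fun i => hy (Fin.castSucc i), ?_⟩
      rw [hA₁]
      convert left_ne_zero_of_mul hay using 3
      ext ⟨j, k⟩
      refine Fin.lastCases ?_ (fun i => ?_) j <;> simp [snoc, p]
    have h2 : A₂ ∉ vanishingIdeal K (tupleSet C (Fin s)) := by
      obtain ⟨w, hw, haw⟩ := notMem_vanishingIdeal.1 ha'
      choose x hxC hxw using hw
      refine notMem_vanishingIdeal.2 ⟨fun ik => x ik.1 ik.2, hxC, ?_⟩
      rw [hA₂]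
      convert haw using 3
      ext ⟨i, k⟩
      exact congrFun (hxw i) k
    obtain ⟨x, hx, hAx⟩ := notMem_vanishingIdeal.1
      (fun hmem => ((hprime s).mem_or_mem hmem).elim h1 h2)
    rw [map_mul, hA₁, hA₂] at hAx
    obtain ⟨c, hc, hc0⟩ := h (snoc x) (by
      intro j
      refine Fin.lastCases ?_ (fun i => ?_) j
      · simpa [hsnoc_last, p] using hy (Fin.last s)
      · simpa [hsnoc_cast] using hx i) (left_ne_zero_of_mul hAx)
    rw [map_prod, Finset.prod_ne_zero_iff] at hc0
    have hmem : (fun k => ∑ i, c i * snoc x (i, k)) ∈ zariskiHull C := fun f hf => by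
      rw [← hT]
      exact hc _ ⟨f, hf, rfl⟩
    refine h' (fun ik => L (fun k => x (ik.1, k)) ik.2)
      (fun i => ⟨_, hx i, rfl⟩) (right_ne_zero_of_mul hAx) (fun i => c (Fin.castSucc i))
      (fun i => by simpa using hc0 (Fin.castSucc i) (Finset.mem_univ _)) ?_
    have := map_mem_zariskiHull L hmem
    convert this using 1
    have hsum : (fun k => ∑ i, c i * snoc x (i, k)) =
        ∑ i : Fin s, c (Fin.castSucc i) • (fun k => x (i, k)) + c (Fin.last s) • p := by
      ext k
      simp [Fin.sum_univ_castSucc, hsnoc_last, hsnoc_cast]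
    rw [hsum, map_add, map_smul, hLp, smul_zero, add_zero, map_sum]
    ext k
    simp

/-- `s` general points of a nondegenerate cone of large codimension are linearly independent, and
their span meets the cone only in the lines through these points. -/
theorem exists_general_tuples {K : Type u} [Field K] [IsAlgClosed K] [CharZero K]
    (s : ℕ) {κ : Type} [Fintype κ] {C : Set (κ → K)} (hC : IsNondegenerateCone C)
    {N : ℕ} (htr : Algebra.trdeg K (CoordRing C) ≤ N) (hN : N + s ≤ Fintype.card κ) :
    ∃ a ∉ vanishingIdeal K (tupleSet C (Fin s)), ∀ x ∈ tupleSet C (Fin s), aeval x a ≠ 0 →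
      LinearIndependent K (fun i k => x (i, k)) ∧
      ∀ c : Fin s → K, (fun k => ∑ i, c i * x (i, k)) ∈ zariskiHull C →
        ∀ i j, c i ≠ 0 → c j ≠ 0 → i = j := by
  classical
  have hprime : (vanishingIdeal K (tupleSet C (Fin s))).IsPrime :=
    isPrime_vanishingIdeal_tupleSet hC.isPrime
  obtain ⟨u₀, hu₀, -⟩ := notMem_vanishingIdeal.1 ((Ideal.ne_top_iff_one _).1 hC.isPrime.ne_top)
  have hli : ∃ a ∉ vanishingIdeal K (tupleSet C (Fin s)), ∀ x ∈ tupleSet C (Fin s),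
      aeval x a ≠ 0 → LinearIndependent K (fun i k => x (i, k)) := by
    have hspan : Submodule.span K C = ⊤ := by
      by_contra hne
      obtain ⟨f, hf0, hf⟩ := Submodule.exists_le_ker_of_lt_top _ (lt_top_iff_ne_top.2 hne)
      have hfx : ∀ x, f x = ∑ k, f (Pi.single k 1) * x k := fun x => by
        conv_lhs => rw [eq_sum_smul_single x, map_sum]
        simp [mul_comm]
      have := hC.nondegenerate (fun k => f (Pi.single k 1)) fun x hx => by
        rw [← hfx]
        exact hf (Submodule.subset_span hx)
      apply hf0
      ext k
      simpa using congrFun this k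
    obtain ⟨e, heC, -, heli⟩ := Submodule.exists_fun_fin_finrank_span_eq K C
    have hcard : s ≤ Module.finrank K (Submodule.span K C) := by
      rw [hspan, finrank_top, Module.finrank_fintype_fun_eq_card]
      omega
    have hli := heli.comp (Fin.castLE hcard) (Fin.castLE_injective hcard)
    -- `C` contains one independent tuple `e`. With `g` a left inverse of its combination map, the
    -- determinant of the vectors `g (x i)` is `1` at `e`, and independence of `x` follows wherever
    -- it is nonzero.
    obtain ⟨g, hg⟩ := LinearMap.exists_leftInverse_of_injective
      (Fintype.linearCombination K (e ∘ Fin.castLE hcard))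
      (LinearMap.ker_eq_bot.2 (linearIndependent_iff_injective_fintypeLinearCombination.1 hli))
    refine ⟨(Matrix.of fun i j => rename (Prod.mk i) (linearForms g j)).det, ?_, ?_⟩
    · refine notMem_vanishingIdeal.2
        ⟨fun ik => e (Fin.castLE hcard ik.1) ik.2, fun i => heC (Fin.castLE hcard i), ?_⟩
      rw [AlgHom.map_det]
      have : (aeval fun ik : Fin s × κ => e (Fin.castLE hcard ik.1) ik.2).mapMatrix
          (Matrix.of fun i j => rename (Prod.mk i) (linearForms g j)) = (1 : Matrix _ _ K) := by
        ext i j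
        rw [AlgHom.mapMatrix_apply, Matrix.map_apply, Matrix.of_apply, aeval_rename]
        change aeval (e (Fin.castLE hcard i)) _ = _
        rw [aeval_linearForms, Matrix.one_apply]
        have := congrFun (LinearMap.congr_fun hg (Pi.single i 1)) j
        simp only [LinearMap.comp_apply, Fintype.linearCombination_apply_single, one_smul,
          LinearMap.id_apply, Function.comp_apply] at this
        rw [this, Pi.single_apply]
        simp only [eq_comm]
      rw [this, Matrix.det_one]
      exact one_ne_zero
    · intro x hx hdet
      rw [AlgHom.map_det] at hdet
      have hrows := Matrix.linearIndependent_rows_of_det_ne_zero hdet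
      have hg' : (g ∘ fun i k => x (i, k)) = fun i => (aeval x).mapMatrix
          (Matrix.of fun i j => rename (Prod.mk i) (linearForms g j)) i := by
        ext i j
        simp only [Function.comp_apply, AlgHom.mapMatrix_apply, Matrix.map_apply,
          Matrix.of_apply, aeval_rename]
        rw [← aeval_linearForms]
        rfl
      refine LinearIndependent.of_comp g ?_
      rw [hg']
      exact hrows
  obtain ⟨a₀, ha₀, h₀⟩ := hli
  -- One open condition for each possible support `S` of the coefficients, obtained from the
  -- previous theorem for `S.card` points.
  have hS : ∀ S : Finset (Fin s), ∃ a ∉ vanishingIdeal K (tupleSet C (Fin s)),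
      2 ≤ S.card → ∀ x ∈ tupleSet C (Fin s), aeval x a ≠ 0 →
      ∀ c : Fin s → K, (∀ i, c i ≠ 0 ↔ i ∈ S) →
        (fun k => ∑ i, c i * x (i, k)) ∉ zariskiHull C := by
    intro S
    by_cases hcard : 2 ≤ S.card
    · have hle : S.card ≤ s := by simpa using S.card_le_univ
      obtain ⟨a, ha, h⟩ := exists_general_tuples_of_two_le hcard hC htr (by omega)
      obtain ⟨y, hy, hay⟩ := notMem_vanishingIdeal.1 ha
      let e := S.equivFin
      refine ⟨rename (fun ik => ((e.symm ik.1 : Fin s), ik.2)) a, ?_, fun _ x hx hxa c hc hmem => ?_⟩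
      · refine notMem_vanishingIdeal.2
          ⟨fun ik => if h : ik.1 ∈ S then y (e ⟨ik.1, h⟩, ik.2) else u₀ ik.2, fun i => ?_, ?_⟩
        · by_cases hi : i ∈ S
          · simpa [hi] using hy (e ⟨i, hi⟩)
          · simpa [hi] using hu₀
        · rw [aeval_rename]
          convert hay using 3
          ext ⟨i, k⟩
          simp
      · rw [aeval_rename] at hxa
        refine h _ (fun i => hx (e.symm i)) hxa (fun i => c (e.symm i))
          (fun i => (hc _).2 (e.symm i).2) ?_
        convert hmem using 1
        ext k
        rw [← Finset.sum_subset (Finset.subset_univ S) fun i _ hi => by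
          rw [← hc, not_not] at hi
          rw [hi, zero_mul], ← Finset.sum_coe_sort S]
        exact Equiv.sum_comp e.symm fun i : S => c i * x (i, k)
    · exact ⟨a₀, ha₀, fun h => absurd h hcard⟩
  choose a ha h using hS
  refine ⟨a₀ * ∏ S, a S, fun hmem => ?_, fun x hx hxa => ?_⟩
  · rcases hprime.mem_or_mem hmem with h | h
    · exact ha₀ h
    · obtain ⟨S, -, hSm⟩ := hprime.prod_mem_iff.1 h
      exact ha S hSm
  · rw [map_mul, map_prod] at hxa
    refine ⟨h₀ x hx (left_ne_zero_of_mul hxa), fun c hc i j hi hj => ?_⟩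
    by_contra hij
    have hS := Finset.prod_ne_zero_iff.1 (right_ne_zero_of_mul hxa)
      (Finset.univ.filter fun i => c i ≠ 0) (Finset.mem_univ _)
    refine h _ ?_ x hx hS c (fun i => by simp) hc
    exact Finset.one_lt_card.2 ⟨i, by simpa using hi, j, by simpa using hj, hij⟩

end GeneralTuples

end GrassmannSecants
end

noncomputable section
attribute [local instance] GrassmannSecants.zariskiTopology
namespace GrassmannSecants

/-! ### Projective varieties and their affine cones. -/

section Cone

open MvPolynomial

theorem IsHomogeneous.aeval_smul_eq {K κ : Type*} [Field K] {f : MvPolynomial κ K} {d : ℕ}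
    (hf : f.IsHomogeneous d) (t : K) (x : κ → K) : aeval (t • x) f = t ^ d * aeval x f := by
  rw [aeval_eq_eval, aeval_eq_eval]
  change eval (t • x) f = t ^ d * eval x f
  simp only [eval_eq, Finset.mul_sum]
  refine Finset.sum_congr rfl fun m hm => ?_
  have hd : ∑ i ∈ m.support, m i = d := by
    rw [← hf (mem_support_iff.mp hm), Finsupp.weight_apply, Finsupp.sum]
    simp
  simp only [Pi.smul_apply, smul_eq_mul, mul_pow, Finset.prod_mul_distrib,
    Finset.prod_pow_eq_pow_sum, hd]
  ring

/-- The restriction of a polynomial to the line through the origin and `x`. -/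
def restrictLine {K κ : Type*} [Field K] (x : κ → K) : MvPolynomial κ K →ₐ[K] Polynomial K :=
  aeval fun k => Polynomial.C (x k) * Polynomial.X

theorem eval_restrictLine {K κ : Type*} [Field K] (x : κ → K) (t : K) (f : MvPolynomial κ K) :
    Polynomial.eval t (restrictLine x f) = aeval (t • x) f := by
  rw [← Polynomial.coe_aeval_eq_eval, restrictLine, comp_aeval_apply]
  congr 2
  ext k
  rw [map_mul, Polynomial.aeval_C, Polynomial.aeval_X, Pi.smul_apply, smul_eq_mul]
  exact mul_comm _ _

/-- Restriction to lines through the origin separates homogeneous components, so statements on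
arbitrary polynomials on a cone reduce to homogeneous ones. -/
theorem coeff_restrictLine {K κ : Type*} [Field K] [Infinite K] (x : κ → K) (f : MvPolynomial κ K)
    (i : ℕ) : (restrictLine x f).coeff i = aeval x (homogeneousComponent i f) := by
  have h : ∀ j, restrictLine x (homogeneousComponent j f) =
      Polynomial.C (aeval x (homogeneousComponent j f)) * Polynomial.X ^ j := fun j =>
    Polynomial.funext fun t => by
      rw [eval_restrictLine, IsHomogeneous.aeval_smul_eq (homogeneousComponent_isHomogeneous j f)]
      rw [Polynomial.eval_mul, Polynomial.eval_C, Polynomial.eval_pow, Polynomial.eval_X, mul_comm]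
  conv_lhs => rw [← sum_homogeneousComponent f, map_sum]
  simp only [h, Polynomial.finsetSum_coeff, Polynomial.coeff_C_mul_X_pow]
  rw [Finset.sum_ite_eq]
  split_ifs with hi
  · rfl
  · rw [homogeneousComponent_eq_zero]
    · simp
    · rw [Finset.mem_range] at hi
      omega

theorem exists_smul_aeval_ne_zero {K κ : Type*} [Field K] [Infinite K] {x : κ → K}
    {f g : MvPolynomial κ K} {i j : ℕ} (hf : aeval x (homogeneousComponent i f) ≠ 0)
    (hg : aeval x (homogeneousComponent j g) ≠ 0) :
    ∃ t : K, t ≠ 0 ∧ aeval (t • x) f ≠ 0 ∧ aeval (t • x) g ≠ 0 := by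
  have hf' : restrictLine x f ≠ 0 := fun h => hf (by rw [← coeff_restrictLine, h]; simp)
  have hg' : restrictLine x g ≠ 0 := fun h => hg (by rw [← coeff_restrictLine, h]; simp)
  by_contra! hcon
  -- The factor `X` excludes the value `t = 0`.
  have : Polynomial.X * restrictLine x f * restrictLine x g = 0 := Polynomial.funext fun t => by
    rw [Polynomial.eval_mul, Polynomial.eval_mul, Polynomial.eval_X, Polynomial.eval_zero,
      eval_restrictLine, eval_restrictLine]
    by_cases ht : t = 0
    · simp [ht]
    · by_cases hft : aeval (t • x) f = 0
      · simp [hft]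
      · simp [hcon t ht hft]
  exact mul_ne_zero (mul_ne_zero Polynomial.X_ne_zero hf') hg' this

theorem exists_homogeneousComponent_ne_zero {K κ : Type*} [Field K] {x : κ → K}
    {f : MvPolynomial κ K} (hf : aeval x f ≠ 0) :
    ∃ i, aeval x (homogeneousComponent i f) ≠ 0 := by
  by_contra! h
  apply hf
  rw [← sum_homogeneousComponent f, map_sum]
  exact Finset.sum_eq_zero fun i _ => h i

theorem homogeneousComponent_mem_vanishingIdeal {K κ : Type*} [Field K] [Infinite K]
    {C : Set (κ → K)} (hC : ∀ (t : K), ∀ x ∈ C, t • x ∈ C) {f : MvPolynomial κ K}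
    (hf : f ∈ vanishingIdeal K C) (i : ℕ) : homogeneousComponent i f ∈ vanishingIdeal K C := by
  intro x hx
  rw [← coeff_restrictLine]
  have : restrictLine x f = 0 := Polynomial.funext fun t => by
    rw [eval_restrictLine, hf _ (hC t x hx), Polynomial.eval_zero]
  simp [this]

theorem isClosed_iff_projZeroLocus {K ι : Type*} [Field K] {Z : Set (ℙ K (ι → K))} :
    IsClosed Z ↔ ∃ S : Set (MvPolynomial ι K), AllHomogeneous S ∧ Z = projZeroLocus S := by
  rw [← isOpen_compl_iff]
  change Zᶜᶜ ∈ _ ↔ _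
  rw [compl_compl]
  rfl

/-- This turns density in the Zariski topology into statements on homogeneous polynomials. -/
theorem mem_closure_iff_aeval {K ι : Type*} [Field K] {A : Set (ℙ K (ι → K))} {p : ℙ K (ι → K)} :
    p ∈ closure A ↔ ∀ (d : ℕ) (f : MvPolynomial ι K), f.IsHomogeneous d →
      (∀ q ∈ A, aeval q.rep f = 0) → aeval p.rep f = 0 := by
  constructor
  · intro hp d f hf h
    have hcl : IsClosed (projZeroLocus {f} : Set (ℙ K (ι → K))) := by
      refine isClosed_iff_projZeroLocus.2 ⟨{f}, ?_, rfl⟩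
      rintro _ rfl
      exact ⟨d, hf⟩
    have hsub : A ⊆ projZeroLocus {f} := by
      rintro q hq _ rfl
      exact h q hq
    exact closure_minimal hsub hcl hp f rfl
  · intro h
    rw [mem_closure_iff]
    intro U hU hpU
    obtain ⟨S, hS, hUS⟩ := isClosed_iff_projZeroLocus.1 hU.isClosed_compl
    have hp : p ∉ projZeroLocus S := by
      rw [← hUS]
      exact fun h => h hpU
    simp only [projZeroLocus, Set.mem_ofPred_eq, not_forall] at hp
    obtain ⟨f, hf, hfp⟩ := hp
    obtain ⟨d, hd⟩ := hS f hf
    by_contra hemp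
    refine hfp (h d f hd fun q hq => ?_)
    have hqU : q ∈ Uᶜ := fun hqU => hemp ⟨q, hqU, hq⟩
    rw [hUS] at hqU
    exact hqU f hf

theorem isOpen_setOf_aeval_rep_ne_zero {K ι : Type*} [Field K] {f : MvPolynomial ι K} {d : ℕ}
    (hf : f.IsHomogeneous d) : IsOpen {p : ℙ K (ι → K) | aeval p.rep f ≠ 0} := by
  rw [← isClosed_compl_iff, isClosed_iff_projZeroLocus]
  refine ⟨{f}, ?_, ?_⟩
  · rintro _ rfl
    exact ⟨d, hf⟩
  · ext p
    simp [projZeroLocus]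

theorem aeval_rep_eq_zero_iff {K ι : Type*} [Field K] {f : MvPolynomial ι K} {d : ℕ}
    (hf : f.IsHomogeneous d) (v : ι → K) (hv : v ≠ 0) :
    aeval (Projectivization.mk K v hv).rep f = 0 ↔ aeval v f = 0 :=
  eval_rep_eq_zero_iff hf v hv

/-- The affine cone over a set of points of projective space. -/
def affineCone {K κ : Type*} [Field K] (X : Set (ℙ K (κ → K))) : Set (κ → K) :=
  {v | ∀ hv : v ≠ 0, Projectivization.mk K v hv ∈ X}

theorem rep_mem_affineCone {K κ : Type*} [Field K] {X : Set (ℙ K (κ → K))} {p : ℙ K (κ → K)}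
    (hp : p ∈ X) : p.rep ∈ affineCone X := fun hv => by
  rwa [Projectivization.mk_rep]

theorem smul_mem_affineCone {K κ : Type*} [Field K] {X : Set (ℙ K (κ → K))} (t : K) (x : κ → K)
    (hx : x ∈ affineCone X) : t • x ∈ affineCone X := by
  intro hv
  convert hx (right_ne_zero_of_smul hv) using 1
  rw [Projectivization.mk_eq_mk_iff']
  exact ⟨t, rfl⟩

theorem exists_eq_smul_rep {K κ : Type*} [Field K] {X : Set (ℙ K (κ → K))} (hX : X.Nonempty)
    {v : κ → K} (hv : v ∈ affineCone X) : ∃ p ∈ X, ∃ t : K, v = t • p.rep := by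
  by_cases h0 : v = 0
  · obtain ⟨p, hp⟩ := hX
    exact ⟨p, hp, 0, by rw [h0, zero_smul]⟩
  · obtain ⟨a, ha⟩ := Projectivization.exists_smul_eq_mk_rep K v h0
    exact ⟨_, hv h0, (a⁻¹ : Kˣ), by rw [← ha, ← Units.smul_def, inv_smul_smul]⟩

theorem zariskiHull_affineCone_subset {K κ : Type*} [Field K] {X : Set (ℙ K (κ → K))}
    (hX : IsClosed X) (hne : X.Nonempty) : zariskiHull (affineCone X) ⊆ affineCone X := by
  intro v hv hv0
  rw [← hX.closure_eq, mem_closure_iff_aeval]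
  intro d f hf h
  rw [aeval_rep_eq_zero_iff hf]
  refine hv f fun w hw => ?_
  obtain ⟨p, hp, t, rfl⟩ := exists_eq_smul_rep hne hw
  rw [IsHomogeneous.aeval_smul_eq hf, h p hp, mul_zero]

theorem exists_homogeneousComponent_rep_ne_zero {K κ : Type*} [Field K] {X : Set (ℙ K (κ → K))}
    (hX : X.Nonempty) {f : MvPolynomial κ K} (hf : f ∉ vanishingIdeal K (affineCone X)) :
    ∃ i, ∃ p ∈ X, aeval p.rep (homogeneousComponent i f) ≠ 0 := by
  obtain ⟨v, hv, hfv⟩ := notMem_vanishingIdeal.1 hf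
  obtain ⟨p, hp, t, rfl⟩ := exists_eq_smul_rep hX hv
  obtain ⟨i, hi⟩ := exists_homogeneousComponent_ne_zero hfv
  rw [IsHomogeneous.aeval_smul_eq (homogeneousComponent_isHomogeneous i f)] at hi
  exact ⟨i, p, hp, right_ne_zero_of_mul hi⟩

theorem mk_mem_span_iff {K V : Type*} [Field K] [AddCommGroup V] [Module K V] (S : Set (ℙ K V))
    (v : V) (hv : v ≠ 0) : Projectivization.mk K v hv ∈ Projectivization.Subspace.span S ↔
      v ∈ Submodule.span K (Projectivization.rep '' S) := by
  constructor
  · intro h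
    have hle : Projectivization.Subspace.span S ≤
        (Submodule.span K (Projectivization.rep '' S)).projectivization := by
      rw [Projectivization.Subspace.span_le_subspace_iff]
      intro p hp
      rw [← p.mk_rep]
      exact Submodule.subset_span ⟨p, hp, rfl⟩
    exact hle h
  · intro h
    rw [← Projectivization.Subspace.mem_submodule_iff]
    refine Submodule.span_le.2 ?_ h
    rintro _ ⟨p, hp, rfl⟩
    rw [SetLike.mem_coe, Projectivization.Subspace.mem_submodule_iff _ p.rep_nonzero, p.mk_rep]
    exact Projectivization.Subspace.subset_span S hp

/-- The affine cone over an irreducible nondegenerate variety. -/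
theorem IsNondegenerateVariety.isNondegenerateCone {K κ : Type*} [Field K] [Infinite K]
    [Fintype κ] {X : Set (ℙ K (κ → K))} (hX : IsNondegenerateVariety X) :
    IsNondegenerateCone (affineCone X) := by
  classical
  refine ⟨⟨?_, fun {f g} hfg => ?_⟩, smul_mem_affineCone, fun l hl => ?_⟩
  · rw [Ideal.ne_top_iff_one, notMem_vanishingIdeal]
    exact ⟨0, fun h => (h rfl).elim, by simp⟩
  · by_contra! hcon
    obtain ⟨i, p, hp, hi⟩ :=
      exists_homogeneousComponent_rep_ne_zero hX.isIrreducible.nonempty hcon.1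
    obtain ⟨j, q, hq, hj⟩ :=
      exists_homogeneousComponent_rep_ne_zero hX.isIrreducible.nonempty hcon.2
    -- The nonvanishing loci of the two homogeneous components are open and meet `X`, hence have a
    -- common point of `X`. On the line over it both `f` and `g` are nonzero at a common scalar
    -- multiple.
    obtain ⟨z, hz, hzi, hzj⟩ := hX.isIrreducible.2 _ _
      (isOpen_setOf_aeval_rep_ne_zero (homogeneousComponent_isHomogeneous i f))
      (isOpen_setOf_aeval_rep_ne_zero (homogeneousComponent_isHomogeneous j g))
      ⟨p, hp, hi⟩ ⟨q, hq, hj⟩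
    obtain ⟨t, -, htf, htg⟩ := exists_smul_aeval_ne_zero hzi hzj
    refine mul_ne_zero htf htg ?_
    rw [← map_mul]
    exact hfg _ (smul_mem_affineCone t _ (rep_mem_affineCone hz))
  · have hle : Projectivization.Subspace.span X ≤
        (LinearMap.ker (Fintype.linearCombination K l)).projectivization := by
      rw [Projectivization.Subspace.span_le_subspace_iff]
      intro p hp
      rw [← p.mk_rep]
      change Fintype.linearCombination K l p.rep = 0
      rw [Fintype.linearCombination_apply, ← hl _ (rep_mem_affineCone hp)]
      exact Finset.sum_congr rfl fun _ _ => by rw [smul_eq_mul, mul_comm]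
    rw [hX.span_eq_top, top_le_iff] at hle
    ext k
    have hk : (Pi.single k 1 : κ → K) ≠ 0 := by simp
    have : Projectivization.mk K (Pi.single k 1 : κ → K) hk ∈
        (LinearMap.ker (Fintype.linearCombination K l)).projectivization := by
      rw [hle, ← Projectivization.Subspace.span_univ]
      exact Projectivization.Subspace.subset_span _ (Set.mem_univ _)
    rw [Submodule.mk_mem_projectivization_iff, LinearMap.mem_ker] at this
    simpa using this

end Cone

end GrassmannSecants
end

noncomputable section
attribute [local instance] GrassmannSecants.zariskiTopology
namespace GrassmannSecants

/-! ### Uniqueness of tensor decompositions. -/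

section Decomposition

theorem segreVec_smul_left {K : Type*} [Field K] {ι κ : Type*} (t : K) (a : ι → K) (x : κ → K) :
    segreVec (t • a) x = t • segreVec a x := by
  ext ij
  simp [segreVec, mul_assoc]

variable {K : Type*} [Field K] {ι κ τ : Type*} [Fintype ι] [DecidableEq ι] [Fintype τ]

/-- The slices of a tensor given by a decomposition with an invertible matrix span the same space
as the second factors of the decomposition, so that they lie in the span of the second factors of
every other decomposition. -/
theorem mem_span_range_of_sum_segreVec_eq {A : Matrix ι ι K} (hA : A.det ≠ 0) {x : ι → κ → K}
    {a : τ → ι → K} {y : τ → κ → K}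
    (h : ∑ l, segreVec (A l) (x l) = ∑ t, segreVec (a t) (y t)) (m : ι) :
    x m ∈ Submodule.span K (Set.range y) := by
  have hrow : ∀ i, ∑ l, A l i • x l = ∑ t, a t i • y t := fun i => by
    ext k
    have := congrFun h (i, k)
    simpa [segreVec] using this
  -- Inverting `A` recovers `x m` from the slices of the tensor, and each slice is a combination of
  -- the `y t`.
  have hx : x m = ∑ i, A⁻¹ i m • ∑ t, a t i • y t := by
    simp only [← hrow, Finset.smul_sum, smul_smul]
    rw [Finset.sum_comm]
    have hB : ∀ l, ∑ i, A l i * A⁻¹ i m = if l = m then 1 else 0 := fun l => by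
      rw [← Matrix.mul_apply, Matrix.mul_nonsing_inv A (isUnit_iff_ne_zero.2 hA),
        Matrix.one_apply]
    simp only [← Finset.sum_smul, mul_comm (A⁻¹ _ _), hB]
    simp
  rw [hx]
  exact Submodule.sum_mem _ fun i _ => Submodule.smul_mem _ _ <| Submodule.sum_mem _ fun t _ =>
    Submodule.smul_mem _ _ <| Submodule.subset_span ⟨t, rfl⟩

theorem card_le_of_sum_segreVec_eq {A : Matrix ι ι K} (hA : A.det ≠ 0) {x : ι → κ → K}
    (hx : LinearIndependent K x) {a : τ → ι → K} {y : τ → κ → K}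
    (h : ∑ l, segreVec (A l) (x l) = ∑ t, segreVec (a t) (y t)) :
    Fintype.card ι ≤ Fintype.card τ := by
  have hle : Submodule.span K (Set.range x) ≤ Submodule.span K (Set.range y) := by
    rw [Submodule.span_le]
    rintro _ ⟨m, rfl⟩
    exact mem_span_range_of_sum_segreVec_eq hA h m
  have := Module.Finite.span_of_finite K (Set.finite_range y)
  calc Fintype.card ι = Module.finrank K (Submodule.span K (Set.range x)) :=
        (finrank_span_eq_card hx).symm
    _ ≤ Module.finrank K (Submodule.span K (Set.range y)) := Submodule.finrank_mono hle
    _ ≤ Fintype.card τ := finrank_range_le_card y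

/-- Uniqueness of the shortest decomposition when the span of the second factors meets the cone
only along those factors. -/
theorem exists_segreVec_eq_of_sum_segreVec_eq {A : Matrix ι ι K} (hA : A.det ≠ 0) {x : ι → κ → K}
    (hx : LinearIndependent K x) {C : Set (κ → K)}
    (hC : ∀ c : ι → K, ∑ i, c i • x i ∈ C → ∀ i j, c i ≠ 0 → c j ≠ 0 → i = j)
    {a : τ → ι → K} {y : τ → κ → K} (hy : ∀ t, y t ∈ C)
    (h : ∑ l, segreVec (A l) (x l) = ∑ t, segreVec (a t) (y t))
    (hcard : Fintype.card τ = Fintype.card ι) (t : τ) :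
    ∃ l, segreVec (a t) (y t) = segreVec (A l) (x l) := by
  classical
  have hle : Submodule.span K (Set.range x) ≤ Submodule.span K (Set.range y) := by
    rw [Submodule.span_le]
    rintro _ ⟨m, rfl⟩
    exact mem_span_range_of_sum_segreVec_eq hA h m
  have := Module.Finite.span_of_finite K (Set.finite_range y)
  have hfx := finrank_span_eq_card hx
  have hfy : Module.finrank K (Submodule.span K (Set.range y)) = Fintype.card τ :=
    le_antisymm (finrank_range_le_card y)
      (by rw [hcard, ← hfx]; exact Submodule.finrank_mono hle)
  have hyi : LinearIndependent K y := linearIndependent_iff_card_eq_finrank_span.2 hfy.symm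
  have heq := Submodule.eq_of_le_of_finrank_eq hle (by rw [hfx, hfy, hcard])
  -- By the equality of spans `y t` lies in the span of `x`, and it lies in the cone, so only one
  -- coefficient is nonzero.
  have hex : ∀ t, ∃ i, ∃ γ : K, γ • x i = y t := fun t => by
    have hmem : y t ∈ Submodule.span K (Set.range x) := by
      rw [heq]
      exact Submodule.subset_span ⟨t, rfl⟩
    obtain ⟨c, hc⟩ := Submodule.mem_span_range_iff_exists_fun K |>.1 hmem
    have hone := hC c (by rw [hc]; exact hy t)
    have hne : ∃ i, c i ≠ 0 := by
      by_contra! h0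
      exact hyi.ne_zero t (by rw [← hc]; simp [h0])
    obtain ⟨i, hi⟩ := hne
    refine ⟨i, c i, ?_⟩
    rw [← hc, Finset.sum_eq_single i _ (by simp)]
    intro j _ hj
    have : c j = 0 := by
      by_contra hcj
      exact hj (hone j i hcj hi)
    rw [this, zero_smul]
  choose σ γ hσ using hex
  have hγ : ∀ t, γ t ≠ 0 := fun t h0 => hyi.ne_zero t (by rw [← hσ, h0, zero_smul])
  have hinj : Function.Injective σ := fun t u htu => by
    by_contra hne
    have := Fintype.linearIndependent_iff.1 hyi (Pi.single t (γ u) - Pi.single u (γ t)) (by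
      simp only [Pi.sub_apply, sub_smul, Finset.sum_sub_distrib, Pi.single_apply, ite_smul,
        zero_smul, Finset.sum_ite_eq', Finset.mem_univ, if_true]
      rw [← hσ, ← hσ, htu, smul_smul, smul_smul, mul_comm, sub_self]) t
    rw [Pi.sub_apply, Pi.single_eq_same, Pi.single_eq_of_ne hne, sub_zero] at this
    exact hγ u this
  have hbij : Function.Bijective σ :=
    (Fintype.bijective_iff_injective_and_card σ).2 ⟨hinj, hcard⟩
  refine ⟨σ t, ?_⟩
  -- With the bijection `σ`, each slice is written in two ways in the independent `x`; comparing
  -- coefficients identifies the first factors.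
  have hcoef : ∀ i, A (σ t) i = a t i * γ t := fun i => by
    have hrow : ∑ l, A l i • x l = ∑ t, a t i • y t := by
      ext k
      have := congrFun h (i, k)
      simpa [segreVec] using this
    rw [← (Equiv.ofBijective σ hbij).sum_comp fun l => A l i • x l] at hrow
    have hxi : LinearIndependent K fun t => x (σ t) := hx.comp σ hinj
    have := Fintype.linearIndependent_iff.1 hxi (fun t => A (σ t) i - a t i * γ t) (by
      simp only [sub_smul, Finset.sum_sub_distrib, mul_smul, hσ]
      rw [sub_eq_zero]
      exact hrow) t
    exact sub_eq_zero.1 this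
  ext ⟨i, k⟩
  simp only [segreVec, hcoef, ← hσ t, Pi.smul_apply, smul_eq_mul, mul_assoc]

end Decomposition

/-! ### From tensor decompositions to rank and identifiability. -/

section Identifiability

variable {K : Type*} [Field K] {ι κ : Type*}

theorem mk_segreVec_mem_segreProduct {X : Set (ℙ K (κ → K))} {a : ι → K} {y : κ → K}
    (h : segreVec a y ≠ 0) (hy : y ∈ affineCone X) :
    Projectivization.mk K (segreVec a y) h ∈ segreProduct ι X := by
  have ha : a ≠ 0 := fun h0 => h (by ext; simp [segreVec, h0])
  have hy0 : y ≠ 0 := fun h0 => h (by ext; simp [segreVec, h0])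
  exact ⟨_, _, hy hy0, (segreMap_mk ha hy0).symm⟩

theorem exists_rep_eq_segreVec {X : Set (ℙ K (κ → K))} {q : ℙ K (ι × κ → K)}
    (hq : q ∈ segreProduct ι X) : ∃ a : ι → K, ∃ y ∈ affineCone X, q.rep = segreVec a y := by
  obtain ⟨u, v, hv, rfl⟩ := hq
  obtain ⟨t, ht⟩ := Projectivization.exists_smul_eq_mk_rep K (segreVec u.rep v.rep)
    (segreVec_ne_zero u.rep_nonzero v.rep_nonzero)
  refine ⟨(t : K) • u.rep, v.rep, rep_mem_affineCone hv, ?_⟩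
  rw [segreVec_smul_left, ← Units.smul_def, ht]
  rfl

theorem IsComputedBy.exists_sum_segreVec {X : Set (ℙ K (κ → K))} {M : ι × κ → K} {hM : M ≠ 0}
    {T : Finset (ℙ K (ι × κ → K))}
    (h : IsComputedBy (segreProduct ι X) (Projectivization.mk K M hM) T) :
    ∃ (a : T → ι → K) (y : T → κ → K), (∀ q, y q ∈ affineCone X) ∧
      (∀ q, ∃ t : K, segreVec (a q) (y q) = t • q.1.rep) ∧ M = ∑ q, segreVec (a q) (y q) := by
  have hmem := (mk_mem_span_iff _ M hM).1 h.2
  rw [Set.image_eq_range, Submodule.mem_span_range_iff_exists_fun] at hmem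
  obtain ⟨c, hc⟩ := hmem
  choose a y hy hay using fun q : T => exists_rep_eq_segreVec (h.1 q.2)
  refine ⟨fun q => c q • a q, y, hy, fun q => ⟨c q, ?_⟩, ?_⟩
  · rw [segreVec_smul_left, hay]
  · simp only [segreVec_smul_left, ← hay]
    exact hc.symm

theorem hasRank_and_isIdentifiable [Fintype ι] [DecidableEq ι] {A : Matrix ι ι K} (hA : A.det ≠ 0) {X : Set (ℙ K (κ → K))}
    {x : ι → κ → K} (hx : LinearIndependent K x) (hxX : ∀ i, x i ∈ affineCone X)
    (hX : ∀ c : ι → K, ∑ i, c i • x i ∈ affineCone X → ∀ i j, c i ≠ 0 → c j ≠ 0 → i = j)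
    (hM : ∑ l, segreVec (A l) (x l) ≠ 0) :
    HasRank (segreProduct ι X) (Projectivization.mk K _ hM) (Fintype.card ι) ∧
      IsIdentifiable (segreProduct ι X) (Projectivization.mk K _ hM) := by
  classical
  have hA0 : ∀ l, A l ≠ 0 := fun l h0 => hA (Matrix.det_eq_zero_of_row_eq_zero l (congrFun h0))
  have hne : ∀ l, segreVec (A l) (x l) ≠ 0 := fun l => segreVec_ne_zero (hA0 l) (hx.ne_zero l)
  set P : ι → ℙ K (ι × κ → K) := fun l => Projectivization.mk K _ (hne l) with hP
  have hlow : ∀ T : Finset (ℙ K (ι × κ → K)),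
      IsComputedBy (segreProduct ι X) (Projectivization.mk K _ hM) T →
        Fintype.card ι ≤ T.card := fun T hT => by
    obtain ⟨a, y, -, -, h⟩ := hT.exists_sum_segreVec
    simpa using card_le_of_sum_segreVec_eq hA hx h
  have hcomp : IsComputedBy (segreProduct ι X) (Projectivization.mk K _ hM)
      (Finset.univ.image P) := by
    constructor
    · intro q hq
      rw [Finset.coe_image] at hq
      obtain ⟨l, -, rfl⟩ := hq
      exact mk_segreVec_mem_segreProduct (hne l) (hxX l)
    · rw [mk_mem_span_iff]
      refine Submodule.sum_mem _ fun l _ => ?_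
      obtain ⟨t, ht⟩ := Projectivization.exists_smul_eq_mk_rep K _ (hne l)
      rw [← inv_smul_smul t (segreVec (A l) (x l)), ht]
      refine Submodule.smul_mem _ _ (Submodule.subset_span ⟨P l, ?_, rfl⟩)
      exact Finset.mem_coe.2 (Finset.mem_image_of_mem P (Finset.mem_univ l))
  have hcard : (Finset.univ.image P).card = Fintype.card ι :=
    le_antisymm Finset.card_image_le (hlow _ hcomp)
  have hrank : HasRank (segreProduct ι X) (Projectivization.mk K _ hM) (Fintype.card ι) := by
    refine ⟨⟨_, hcard, hcomp⟩, ?_⟩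
    rintro _ ⟨T, rfl, hT⟩
    exact hlow T hT
  refine ⟨hrank, _, hrank, _, ⟨hcard, hcomp⟩, ?_⟩
  rintro T ⟨hTcard, hT⟩
  obtain ⟨a, y, hy, hay, h⟩ := hT.exists_sum_segreVec
  refine Finset.eq_of_subset_of_card_le (fun q hq => ?_) (by rw [hcard, hTcard])
  obtain ⟨l, hl⟩ := exists_segreVec_eq_of_sum_segreVec_eq hA hx hX hy h (by simpa using hTcard)
    ⟨q, hq⟩
  obtain ⟨t, ht⟩ := hay ⟨q, hq⟩
  refine Finset.mem_image.2 ⟨l, Finset.mem_univ l, ?_⟩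
  rw [← q.mk_rep, hP, Projectivization.mk_eq_mk_iff']
  exact ⟨t, by rw [← ht, hl]⟩

end Identifiability

end GrassmannSecants
end

noncomputable section
attribute [local instance] GrassmannSecants.zariskiTopology
namespace GrassmannSecants

/-! ### Images of irreducible sets under polynomial maps. -/

section ConstructibleImage

open MvPolynomial

universe u

theorem vanishingIdeal_zariskiHull {K κ : Type*} [Field K] (C : Set (κ → K)) :
    vanishingIdeal K (zariskiHull C) = vanishingIdeal K C :=
  le_antisymm (fun _ hf x hx => hf x (subset_zariskiHull C hx)) fun _ hf _ hx => hx _ hf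

/-- The cylinder over an irreducible set is irreducible. -/
theorem isPrime_vanishingIdeal_cylinder {K α β : Type*} [Field K] [Infinite K] {B : Set (β → K)}
    (hB : (vanishingIdeal K B).IsPrime) :
    (vanishingIdeal K {w : α ⊕ β → K | w ∘ Sum.inr ∈ B}).IsPrime := by
  obtain ⟨b₀, hb₀, -⟩ := notMem_vanishingIdeal.1 ((Ideal.ne_top_iff_one _).1 hB.ne_top)
  refine ⟨?_, fun {f g} hfg => ?_⟩
  · rw [Ideal.ne_top_iff_one, notMem_vanishingIdeal]
    exact ⟨Sum.elim 0 b₀, hb₀, by simp⟩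
  · by_contra! hcon
    obtain ⟨⟨u, hu, hfu⟩, ⟨v, hv, hgv⟩⟩ := And.intro (notMem_vanishingIdeal.1 hcon.1)
      (notMem_vanishingIdeal.1 hcon.2)
    let R : (α → K) → MvPolynomial (α ⊕ β) K →ₐ[K] MvPolynomial β K := fun a =>
      aeval (Sum.elim (fun i => MvPolynomial.C (a i)) X)
    have hR : ∀ (a : α → K) (b : β → K) f, aeval b (R a f) = aeval (Sum.elim a b) f :=
      fun a b f => aeval_aeval_eq (fun i => by cases i <;> simp) f
    let L : (β → K) → MvPolynomial (α ⊕ β) K →ₐ[K] MvPolynomial α K := fun b =>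
      aeval (Sum.elim X (fun i => MvPolynomial.C (b i)))
    have hL : ∀ (a : α → K) (b : β → K) f, aeval a (L b f) = aeval (Sum.elim a b) f :=
      fun a b f => aeval_aeval_eq (fun i => by cases i <;> simp) f
    have hmem : ∀ {w : α ⊕ β → K} {f}, w ∘ Sum.inr ∈ B → aeval w f ≠ 0 →
        R (w ∘ Sum.inl) f ∉ vanishingIdeal K B := fun {w f} hw hwf => by
      refine notMem_vanishingIdeal.2 ⟨w ∘ Sum.inr, hw, ?_⟩
      rwa [hR, Sum.elim_comp_inl_inr]
    obtain ⟨b, hb, hfgb⟩ := notMem_vanishingIdeal.1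
      (mt hB.mem_or_mem (not_or.2 ⟨hmem hu hfu, hmem hv hgv⟩))
    rw [map_mul, hR, hR] at hfgb
    have hLf : L b f ≠ 0 := fun h0 => left_ne_zero_of_mul hfgb (by rw [← hL, h0, map_zero])
    have hLg : L b g ≠ 0 := fun h0 => right_ne_zero_of_mul hfgb (by rw [← hL, h0, map_zero])
    refine mul_ne_zero hLf hLg (MvPolynomial.funext fun a => ?_)
    rw [← map_mul, map_zero]
    exact (hL a b _).trans (hfg _ (by simpa using hb))

/-- The image of a set under a polynomial map. -/
def polynomialImage {K σ τ : Type*} [Field K] (φ : σ → MvPolynomial τ K) (S : Set (τ → K)) :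
    Set (σ → K) :=
  (fun w i => aeval w (φ i)) '' S

theorem mem_vanishingIdeal_polynomialImage {K σ τ : Type*} [Field K] {φ : σ → MvPolynomial τ K}
    {S : Set (τ → K)} {f : MvPolynomial σ K} :
    f ∈ vanishingIdeal K (polynomialImage φ S) ↔ aeval φ f ∈ vanishingIdeal K S := by
  have h : ∀ w : τ → K, aeval (fun i => aeval w (φ i)) f = aeval w (aeval φ f) := fun w =>
    (aeval_aeval_eq (fun _ => rfl) f).symm
  constructor
  · intro hf w hw
    rw [← h]
    exact hf _ ⟨w, hw, rfl⟩
  · rintro hf _ ⟨w, hw, rfl⟩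
    rw [h]
    exact hf w hw

theorem isPrime_vanishingIdeal_polynomialImage {K σ τ : Type*} [Field K]
    {φ : σ → MvPolynomial τ K} {S : Set (τ → K)} (hS : (vanishingIdeal K S).IsPrime) :
    (vanishingIdeal K (polynomialImage φ S)).IsPrime := by
  have : vanishingIdeal K (polynomialImage φ S) = (vanishingIdeal K S).comap (aeval φ) := by
    ext f
    rw [mem_vanishingIdeal_polynomialImage, Ideal.mem_comap]
  rw [this]
  exact Ideal.IsPrime.comap _

/-- The image of a nonempty basic open subset of an irreducible closed set contains a nonempty
basic open subset of its closure. -/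
theorem exists_lift_of_general {K : Type u} [Field K] [IsAlgClosed K] {σ τ : Type} [Finite σ]
    [Finite τ] {φ : σ → MvPolynomial τ K} {S : Set (τ → K)} (hS : (vanishingIdeal K S).IsPrime)
    {g : MvPolynomial τ K} (hg : g ∉ vanishingIdeal K S) :
    ∃ ρ ∉ vanishingIdeal K (polynomialImage φ S), ∀ z ∈ zariskiHull (polynomialImage φ S),
      aeval z ρ ≠ 0 → ∃ w ∈ zariskiHull S, (fun i => aeval w (φ i)) = z ∧ aeval w g ≠ 0 := by
  set Q : Set (MvPolynomial (σ ⊕ τ) K) :=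
    Set.range (fun i => X (Sum.inl i) - rename Sum.inr (φ i)) ∪
      rename Sum.inr '' (vanishingIdeal K S : Set (MvPolynomial τ K)) with hQ
  have hren : ∀ (z : σ → K) (w : τ → K) (f : MvPolynomial τ K),
      aeval (Sum.elim z w) (rename Sum.inr f : MvPolynomial (σ ⊕ τ) K) = aeval w f :=
    fun z w f => by rw [aeval_rename, Sum.elim_comp_inr]
  have hQiff : ∀ (z : σ → K) (w : τ → K), (∀ q ∈ Q, aeval (Sum.elim z w) q = 0) ↔
      (fun i => aeval w (φ i)) = z ∧ w ∈ zariskiHull S := by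
    intro z w
    constructor
    · intro h
      refine ⟨funext fun i => ?_, fun f hf => ?_⟩
      · have := h _ (Or.inl ⟨i, rfl⟩)
        rw [map_sub, aeval_X, hren, Sum.elim_inl] at this
        exact (sub_eq_zero.1 this).symm
      · rw [← hren z]
        exact h _ (Or.inr ⟨f, hf, rfl⟩)
    · rintro ⟨rfl, hw⟩ _ (⟨i, rfl⟩ | ⟨f, hf, rfl⟩)
      · rw [map_sub, aeval_X, hren, Sum.elim_inl, sub_self]
      · rw [hren]
        exact hw f hf
  rcases elimination_alternative (zariskiHull (polynomialImage φ S))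
    (by rw [vanishingIdeal_zariskiHull]; exact isPrime_vanishingIdeal_polynomialImage hS)
    Q (rename Sum.inr g) with ⟨a, ha, h⟩ | ⟨⟨ρ, hρ, h⟩, -⟩
  -- The unsolvable case is impossible: a point of `S` where `g` and the pullback of `a` are nonzero
  -- is itself a solution over its image.
  · rw [vanishingIdeal_zariskiHull, mem_vanishingIdeal_polynomialImage] at ha
    obtain ⟨w, hw, hagw⟩ := notMem_vanishingIdeal.1 (mt hS.mem_or_mem (not_or.2 ⟨ha, hg⟩))
    rw [map_mul, aeval_aeval_eq (fun _ => rfl)] at hagw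
    refine absurd ?_ (right_ne_zero_of_mul hagw)
    have := h _ (subset_zariskiHull _ ⟨w, hw, rfl⟩) (left_ne_zero_of_mul hagw) w
      ((hQiff _ _).2 ⟨rfl, subset_zariskiHull _ hw⟩)
    rwa [hren] at this
  · rw [vanishingIdeal_zariskiHull] at hρ
    refine ⟨ρ, hρ, fun z hz hzρ => ?_⟩
    obtain ⟨w, hwQ, hwg⟩ := h z hz hzρ
    obtain ⟨hwz, hw⟩ := (hQiff z w).1 hwQ
    exact ⟨w, hw, hwz, by rwa [hren] at hwg⟩

end ConstructibleImage

/-! ### The general point of the secant variety. -/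

section GeneralPoint

open MvPolynomial

universe u

variable {K : Type u} [Field K] {ι κ : Type}

/-- The entries of the tensor `∑ l, segreVec (a l) (x l)` as polynomials in `a` and `x`. -/
def segreSum (K : Type u) [Field K] (ι κ : Type) [Fintype ι] (ik : ι × κ) :
    MvPolynomial ((ι × ι) ⊕ (ι × κ)) K :=
  ∑ l, X (Sum.inl (l, ik.1)) * X (Sum.inr (l, ik.2))

theorem aeval_segreSum [Fintype ι] (w : (ι × ι) ⊕ (ι × κ) → K) :
    (fun ik => aeval w (segreSum K ι κ ik)) =
      ∑ l, segreVec (fun i => w (Sum.inl (l, i))) (fun k => w (Sum.inr (l, k))) := by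
  ext ik
  simp [segreSum, segreVec]

/-- The parameter space for sums of decomposable tensors with second factors in `C`. -/
def segreParam (ι : Type) (C : Set (κ → K)) : Set ((ι × ι) ⊕ (ι × κ) → K) :=
  {w | w ∘ Sum.inr ∈ tupleSet C ι}

/-- Lifts of general points are found only in the hull of the parameter set; for a closed cone they
are actual parameters. -/
theorem zariskiHull_segreParam {C : Set (κ → K)} (hC : zariskiHull C ⊆ C) :
    zariskiHull (segreParam ι C) ⊆ segreParam ι C := by
  intro w hw i
  refine hC fun f hf => ?_
  have h : ∀ v : (ι × ι) ⊕ (ι × κ) → K, aeval v (rename (fun k => Sum.inr (i, k)) f :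
      MvPolynomial ((ι × ι) ⊕ (ι × κ)) K) = aeval (fun k => v (Sum.inr (i, k))) f := fun v => by
    rw [aeval_rename]
    rfl
  have := hw (rename (fun k => Sum.inr (i, k)) f) fun v hv => by
    rw [h]
    exact hf _ (hv i)
  rwa [h] at this

theorem smul_mem_polynomialImage_segreSum [Fintype ι] {C : Set (κ → K)} (t : K) (z : ι × κ → K)
    (hz : z ∈ polynomialImage (segreSum K ι κ) (segreParam ι C)) :
    t • z ∈ polynomialImage (segreSum K ι κ) (segreParam ι C) := by
  obtain ⟨w, hw, rfl⟩ := hz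
  refine ⟨Sum.elim (t • w ∘ Sum.inl) (w ∘ Sum.inr), hw, ?_⟩
  beta_reduce
  rw [aeval_segreSum, aeval_segreSum, Finset.smul_sum]
  refine Finset.sum_congr rfl fun l _ => ?_
  rw [← segreVec_smul_left]
  rfl

theorem rep_mem_polynomialImage_segreSum [Fintype ι] {X : Set (ℙ K (κ → K))}
    {p : ℙ K (ι × κ → K)} {T : Finset (ℙ K (ι × κ → K))} (hT : T.card = Fintype.card ι)
    (h : IsComputedBy (segreProduct ι X) p T) :
    p.rep ∈ polynomialImage (segreSum K ι κ) (segreParam ι (affineCone X)) := by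
  rw [← p.mk_rep] at h
  obtain ⟨a, y, hy, -, hsum⟩ := h.exists_sum_segreVec
  let e : ι ≃ T := Fintype.equivOfCardEq (by simpa using hT.symm)
  refine ⟨Sum.elim (fun li => a (e li.1) li.2) (fun lk => y (e lk.1) lk.2), fun i => hy (e i), ?_⟩
  beta_reduce
  rw [aeval_segreSum, hsum]
  exact e.sum_comp fun q => segreVec (a q) (y q)

/-- Good parameters, with `G ≠ 0` and invertible matrix, are open and nonempty in an irreducible
parameter space. Their image contains a nonempty open part of the closure of all sums, and there
rank and uniqueness are known. -/
theorem sIdentifiable_of_general_tuples [IsAlgClosed K] [Fintype ι] [Nonempty ι] [Fintype κ]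
    {X : Set (ℙ K (κ → K))} (hX : IsNondegenerateVariety X) {G : MvPolynomial (ι × κ) K}
    (hG : G ∉ vanishingIdeal K (tupleSet (affineCone X) ι))
    (hgen : ∀ x ∈ tupleSet (affineCone X) ι, aeval x G ≠ 0 →
      LinearIndependent K (fun i k => x (i, k)) ∧ ∀ c : ι → K,
        ∑ i, c i • (fun k => x (i, k)) ∈ affineCone X → ∀ i j, c i ≠ 0 → c j ≠ 0 → i = j) :
    SIdentifiable (segreProduct ι X) (Fintype.card ι) := by
  classical
  set C := affineCone X with hCdef
  set Y := segreProduct ι X with hYdef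
  set S := segreParam ι C with hSdef
  set W := polynomialImage (segreSum K ι κ) S with hWdef
  have hCone := hX.isNondegenerateCone
  have hS : (vanishingIdeal K S).IsPrime :=
    isPrime_vanishingIdeal_cylinder (isPrime_vanishingIdeal_tupleSet hCone.isPrime)
  set Δ : Matrix ι ι (MvPolynomial ((ι × ι) ⊕ (ι × κ)) K) :=
    Matrix.of fun l i => MvPolynomial.X (Sum.inl (l, i)) with hΔ
  set g := rename Sum.inr G * Δ.det with hgdef
  have hgw : ∀ w : (ι × ι) ⊕ (ι × κ) → K, aeval w g =
      aeval (w ∘ Sum.inr) G * (Matrix.of fun l i => w (Sum.inl (l, i)) : Matrix ι ι K).det := by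
    intro w
    rw [hgdef, map_mul, aeval_rename, AlgHom.map_det]
    congr 2
    ext l i
    simp [hΔ]
  have hg : g ∉ vanishingIdeal K S := by
    obtain ⟨x, hx, hGx⟩ := notMem_vanishingIdeal.1 hG
    refine notMem_vanishingIdeal.2 ⟨Sum.elim (fun li => (1 : Matrix ι ι K) li.1 li.2) x, hx, ?_⟩
    rw [hgw]
    refine mul_ne_zero hGx ?_
    change (1 : Matrix ι ι K).det ≠ 0
    rw [Matrix.det_one]
    exact one_ne_zero
  have hgood : ∀ w ∈ S, aeval w g ≠ 0 →
      ∃ hM : (fun ik => aeval w (segreSum K ι κ ik)) ≠ 0,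
        HasRank Y (Projectivization.mk K _ hM) (Fintype.card ι) ∧
          IsIdentifiable Y (Projectivization.mk K _ hM) := by
    intro w hw hwg
    rw [hgw] at hwg
    obtain ⟨hli, hc⟩ := hgen _ hw (left_ne_zero_of_mul hwg)
    have hdet := right_ne_zero_of_mul hwg
    rw [aeval_segreSum]
    have hM : ∑ l, segreVec (fun i => w (Sum.inl (l, i))) (fun k => w (Sum.inr (l, k))) ≠ 0 := by
      intro h0
      -- The zero tensor would have a decomposition of length `0`, shorter than the nonempty `ι`
      -- allows.
      have := card_le_of_sum_segreVec_eq (τ := Empty) hdet hli (a := Empty.elim)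
        (y := Empty.elim) (h0.trans (Fintype.sum_empty _).symm)
      rw [Fintype.card_empty, Nat.le_zero] at this
      exact Fintype.card_ne_zero this
    exact ⟨hM, hasRank_and_isIdentifiable hdet hli hw hc hM⟩
  obtain ⟨ρ, hρ, hlift⟩ := exists_lift_of_general (φ := segreSum K ι κ) hS hg
  obtain ⟨z, hz, hzρ⟩ := notMem_vanishingIdeal.1 hρ
  -- An open set of projective space needs a homogeneous equation, and `ρ` need not be homogeneous.
  obtain ⟨d, hd⟩ := exists_homogeneousComponent_ne_zero hzρ
  have hρd : homogeneousComponent d ρ ∉ vanishingIdeal K W := notMem_vanishingIdeal.2 ⟨z, hz, hd⟩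
  have hhom := homogeneousComponent_isHomogeneous d ρ
  set U : Set (ℙ K (ι × κ → K)) := {p | aeval p.rep (homogeneousComponent d ρ) ≠ 0} with hUdef
  set Sec : Set (ℙ K (ι × κ → K)) :=
    {p | ∃ T : Finset (ℙ K (ι × κ → K)), T.card = Fintype.card ι ∧ IsComputedBy Y p T} with hSec
  have hdense : ∀ (e : ℕ) (f : MvPolynomial (ι × κ) K), f.IsHomogeneous e →
      f ∉ vanishingIdeal K W → ∃ q ∈ U ∩ Sec, aeval q.rep f ≠ 0 := by
    intro e f hf hfW
    have hmem := mt hS.mem_or_mem (not_or.2 ⟨mt hS.mem_or_mem (not_or.2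
      ⟨mt mem_vanishingIdeal_polynomialImage.2 hfW,
        mt mem_vanishingIdeal_polynomialImage.2 hρd⟩), hg⟩)
    obtain ⟨w, hw, hne⟩ := notMem_vanishingIdeal.1 hmem
    rw [map_mul, map_mul, aeval_aeval_eq (fun _ => rfl), aeval_aeval_eq (fun _ => rfl)] at hne
    obtain ⟨hM, hrank, -⟩ := hgood w hw (right_ne_zero_of_mul hne)
    refine ⟨Projectivization.mk K _ hM, ⟨?_, hrank.1⟩, ?_⟩
    · exact mt (aeval_rep_eq_zero_iff hhom _ hM).1
        (right_ne_zero_of_mul (left_ne_zero_of_mul hne))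
    · exact mt (aeval_rep_eq_zero_iff hf _ hM).1 (left_ne_zero_of_mul (left_ne_zero_of_mul hne))
  have hsub : U ∩ Sec ⊆ U ∩ secantVariety Y (Fintype.card ι) :=
    Set.inter_subset_inter_right _ subset_closure
  refine ⟨U, isOpen_setOf_aeval_rep_ne_zero hhom, ?_, ?_, ?_⟩
  · obtain ⟨q, hq, -⟩ := hdense d _ hhom hρd
    exact ⟨q, hsub hq⟩
  · refine closure_minimal (fun p hp => closure_mono hsub ?_) isClosed_closure
    rw [mem_closure_iff_aeval]
    intro e f hf h
    by_contra hfp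
    obtain ⟨T, hT, hpT⟩ := hp
    obtain ⟨q, hq, hfq⟩ := hdense e f hf
      (notMem_vanishingIdeal.2 ⟨_, rep_mem_polynomialImage_segreSum hT hpT, hfp⟩)
    exact hfq (h q hq)
  · rintro p ⟨hpU, hpS⟩
    have hpW : p.rep ∈ zariskiHull W := by
      intro f hf
      by_contra hfp
      obtain ⟨e, he⟩ := exists_homogeneousComponent_ne_zero hfp
      refine he (mem_closure_iff_aeval.1 hpS e _ (homogeneousComponent_isHomogeneous e f) ?_)
      rintro q ⟨T, hT, hqT⟩
      exact homogeneousComponent_mem_vanishingIdeal smul_mem_polynomialImage_segreSum hf e _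
        (rep_mem_polynomialImage_segreSum hT hqT)
    -- On `U` only the component of degree `d` is known not to vanish; rescaling the representative
    -- makes `ρ` itself nonzero.
    obtain ⟨t, ht, htρ, -⟩ := exists_smul_aeval_ne_zero hpU hpU
    obtain ⟨w, hw, hwz, hwg⟩ := hlift (t • p.rep)
      (smul_mem_zariskiHull smul_mem_polynomialImage_segreSum t hpW) htρ
    have hhull := zariskiHull_affineCone_subset hX.isClosed hX.isIrreducible.nonempty
    obtain ⟨hM, hres⟩ := hgood w (zariskiHull_segreParam hhull hw) hwg
    have hp : Projectivization.mk K _ hM = p := by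
      conv_rhs => rw [← p.mk_rep]
      rw [Projectivization.mk_eq_mk_iff']
      exact ⟨t, hwz.symm⟩
    rwa [hp] at hres

end GeneralPoint

end GrassmannSecants
end

noncomputable section
attribute [local instance] GrassmannSecants.zariskiTopology
namespace GrassmannSecants

/-! ### Transcendence degree of the cone versus Krull dimension of the variety. -/

section Chart

open MvPolynomial CoordRing

universe u

/-- Homogenization of a polynomial by the variable `k`. -/
def homogenizeAt {K κ : Type*} [Field K] (k : κ) (f : MvPolynomial κ K) : MvPolynomial κ K :=
  ∑ i ∈ Finset.range (f.totalDegree + 1), homogeneousComponent i f * X k ^ (f.totalDegree - i)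

theorem homogenizeAt_isHomogeneous {K κ : Type*} [Field K] (k : κ) (f : MvPolynomial κ K) :
    (homogenizeAt k f).IsHomogeneous f.totalDegree := by
  refine IsHomogeneous.sum _ _ _ fun i hi => ?_
  have := (homogeneousComponent_isHomogeneous i f).mul
    ((isHomogeneous_X K k).pow (f.totalDegree - i))
  rw [Finset.mem_range] at hi
  rwa [one_mul, Nat.add_sub_cancel' (by omega)] at this

theorem aeval_homogenizeAt {K κ : Type*} [Field K] {k : κ} (f : MvPolynomial κ K) {v : κ → K}
    (hv : v k = 1) : aeval v (homogenizeAt k f) = aeval v f := by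
  conv_rhs => rw [← sum_homogeneousComponent f]
  simp [homogenizeAt, hv]

/-- The affine chart of a cone on which the coordinate `k` is `1`. -/
def coneChart {K κ : Type*} [Field K] (C : Set (κ → K)) (k : κ) : Set (κ → K) :=
  {v | v k = 1 ∧ v ∈ C}

theorem inv_smul_mem_coneChart {K κ : Type*} [Field K] {C : Set (κ → K)}
    (hC : ∀ (t : K), ∀ x ∈ C, t • x ∈ C) {k : κ} {v : κ → K} (hv : v ∈ C) (hk : v k ≠ 0) :
    (v k)⁻¹ • v ∈ coneChart C k :=
  ⟨by simp [hk], hC _ _ hv⟩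

theorem zariskiHull_coneChart {K κ : Type*} [Field K] {C : Set (κ → K)} (hC : zariskiHull C ⊆ C)
    (k : κ) : zariskiHull (coneChart C k) ⊆ coneChart C k := by
  intro v hv
  refine ⟨?_, hC fun f hf => hv f fun w hw => hf w hw.2⟩
  have := hv (X k - 1) fun w hw => by simp [hw.1]
  simpa [sub_eq_zero] using this

theorem isPrime_vanishingIdeal_coneChart {K κ : Type*} [Field K] {C : Set (κ → K)}
    (hC : ∀ (t : K), ∀ x ∈ C, t • x ∈ C) (hprime : (vanishingIdeal K C).IsPrime) {k : κ}
    (hk : X k ∉ vanishingIdeal K C) : (vanishingIdeal K (coneChart C k)).IsPrime := by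
  refine ⟨?_, fun {f g} hfg => ?_⟩
  · rw [Ideal.ne_top_iff_one, notMem_vanishingIdeal]
    obtain ⟨v, hv, hvk⟩ := notMem_vanishingIdeal.1 hk
    rw [aeval_X] at hvk
    exact ⟨_, inv_smul_mem_coneChart hC hv hvk, by simp⟩
  · by_contra! hcon
    have hmem : ∀ {f}, f ∉ vanishingIdeal K (coneChart C k) →
        homogenizeAt k f ∉ vanishingIdeal K C := fun {f} hf => by
      obtain ⟨v, hv, hfv⟩ := notMem_vanishingIdeal.1 hf
      exact notMem_vanishingIdeal.2 ⟨v, hv.2, by rwa [aeval_homogenizeAt f hv.1]⟩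
    obtain ⟨v, hv, hne⟩ := notMem_vanishingIdeal.1 (mt hprime.mem_or_mem (not_or.2
      ⟨mt hprime.mem_or_mem (not_or.2 ⟨hmem hcon.1, hmem hcon.2⟩), hk⟩))
    rw [map_mul, map_mul, aeval_X] at hne
    have hvk := right_ne_zero_of_mul hne
    have hw := inv_smul_mem_coneChart hC hv hvk
    have hval : ∀ f, aeval v (homogenizeAt k f) ≠ 0 → aeval ((v k)⁻¹ • v) f ≠ 0 := fun f hf => by
      rw [← aeval_homogenizeAt f hw.1,
        IsHomogeneous.aeval_smul_eq (homogenizeAt_isHomogeneous k f)]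
      exact mul_ne_zero (pow_ne_zero _ (inv_ne_zero hvk)) hf
    refine mul_ne_zero (hval f (left_ne_zero_of_mul (left_ne_zero_of_mul hne)))
      (hval g (right_ne_zero_of_mul (left_ne_zero_of_mul hne))) ?_
    rw [← map_mul]
    exact hfg _ hw

/-- The coordinate ring of a cone embeds into the polynomial ring over the coordinate ring of a
chart. -/
theorem exists_injective_coordRing_coneChart {K : Type u} {κ : Type} [Field K] [Infinite K]
    {C : Set (κ → K)} (hC : ∀ (t : K), ∀ x ∈ C, t • x ∈ C)
    (hprime : (vanishingIdeal K C).IsPrime) {k : κ} (hk : X k ∉ vanishingIdeal K C) :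
    ∃ F : CoordRing C →ₐ[K] Polynomial (CoordRing (coneChart C k)), Function.Injective F := by
  set z : κ → Polynomial (CoordRing (coneChart C k)) :=
    fun j => Polynomial.C (coord (coneChart C k) j) * Polynomial.X with hz
  have hzero : ∀ f : MvPolynomial κ K, aeval z f = 0 ↔ ∀ w ∈ coneChart C k, ∀ t : K, aeval (t • w) f = 0 := by
    intro f
    have hval : ∀ (w : coneChart C k) (t : K),
        ((aeval z f).map (evalAt (coneChart C k) w : CoordRing (coneChart C k) →+* K)).eval t =
          aeval (t • w.1) f := by
      intro w t
      have : restrictLine w.1 f =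
          Polynomial.mapAlgHom (evalAt (coneChart C k) w) (aeval z f) := by
        rw [restrictLine, comp_aeval_apply]
        congr 2
        ext j : 1
        simp [hz]
      rw [← eval_restrictLine, this]
      rfl
    constructor
    · intro h w hw t
      rw [← hval ⟨w, hw⟩, h]
      simp
    · intro h
      ext i
      rw [Polynomial.coeff_zero]
      obtain ⟨p, hp⟩ := mk_surjective (coneChart C k) ((aeval z f).coeff i)
      rw [← hp, mk_eq_zero_iff]
      intro w hw
      have h0 : (aeval z f).map (evalAt (coneChart C k) ⟨w, hw⟩ :
          CoordRing (coneChart C k) →+* K) = 0 := Polynomial.funext fun t => by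
        rw [hval, h w hw t, Polynomial.eval_zero]
      have := congrArg (fun q => q.coeff i) h0
      simp only [Polynomial.coeff_map, Polynomial.coeff_zero, ← hp] at this
      exact this
  refine ⟨CoordRing.lift C z fun f hf => (hzero f).2 fun w hw t => hf _ (hC t w hw.2), ?_⟩
  rw [injective_iff_map_eq_zero]
  intro f hf
  obtain ⟨f, rfl⟩ := mk_surjective C f
  rw [mk_eq_zero_iff]
  have hf' := (hzero f).1 hf
  -- The chart only sees points with `v k ≠ 0`; multiplying by `X k` covers the others, and
  -- primality removes the factor again.
  refine (hprime.mem_or_mem (y := X k) fun v hv => ?_).resolve_right hk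
  rw [map_mul, aeval_X]
  by_cases hvk : v k = 0
  · rw [hvk, mul_zero]
  · have := hf' _ (inv_smul_mem_coneChart hC hv hvk) (v k)
    rw [smul_inv_smul₀ hvk] at this
    rw [this, zero_mul]

/-- Noether normalization: the transcendence degree of a finitely generated domain `A`, which is one
less than that of `A[X]`, is at most its
Krull dimension. -/
theorem exists_trdeg_polynomial_le {K A : Type u} [Field K] [CommRing A] [IsDomain A] [Algebra K A]
    [Algebra.FiniteType K A] : ∃ d : ℕ, Algebra.trdeg K (Polynomial A) = d + 1 ∧
      (d : WithBot ℕ∞) ≤ ringKrullDim A := by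
  obtain ⟨d, φ, hφ, hint⟩ := exists_integral_inj_algHom_of_fg K A
  let _ : Algebra (MvPolynomial (Fin d) K) A := φ.toRingHom.toAlgebra
  have : IsScalarTower K (MvPolynomial (Fin d) K) A :=
    IsScalarTower.of_algebraMap_eq fun r => (φ.commutes r).symm
  have : Algebra.IsIntegral (MvPolynomial (Fin d) K) A := ⟨hint⟩
  have : FaithfulSMul (MvPolynomial (Fin d) K) A :=
    (faithfulSMul_iff_algebraMap_injective _ _).2 hφ
  have hle : (d : WithBot ℕ∞) ≤ ringKrullDim A := by
    have hd : (d : WithBot ℕ∞) ≤ ringKrullDim (MvPolynomial (Fin d) K) := by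
      rw [MvPolynomial.ringKrullDim_of_isNoetherianRing]
      simp
    -- A chain of `d` steps in the polynomial ring is lifted to the integral extension `A` by going
    -- up.
    obtain ⟨l, hl⟩ := Order.le_krullDim_iff.1 hd
    obtain ⟨Q, -, hQ, hQl⟩ := Ideal.exists_ideal_over_prime_of_isIntegral (S := A)
      l.head.asIdeal ⊥ (by
        rw [← RingHom.ker_eq_comap_bot, (RingHom.injective_iff_ker_eq_bot
          (algebraMap (MvPolynomial (Fin d) K) A)).1 hφ]
        exact bot_le)
    have : Q.LiesOver l.head.asIdeal := ⟨hQl.symm⟩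
    obtain ⟨L, hL, -, -⟩ := Ideal.exists_ltSeries_of_hasGoingUp l Q
    rw [← hl, ← hL]
    exact Order.LTSeries.length_le_krullDim L
  refine ⟨d, ?_, hle⟩
  have h1 := trdeg_add_eq K (MvPolynomial (Fin d) K) (A := A)
  have h2 := trdeg_add_eq K A (A := Polynomial A)
  rw [← h2, ← h1, Polynomial.trdeg_of_isDomain, MvPolynomial.trdeg_of_isDomain,
    trdeg_eq_zero]
  simp

theorem exists_isHomogeneous_of_mem_isOpen {K ι : Type*} [Field K] {U : Set (ℙ K (ι → K))}
    (hU : IsOpen U) {p : ℙ K (ι → K)} (hp : p ∈ U) :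
    ∃ (d : ℕ) (f : MvPolynomial ι K), f.IsHomogeneous d ∧ aeval p.rep f ≠ 0 ∧
      ∀ q : ℙ K (ι → K), aeval q.rep f ≠ 0 → q ∈ U := by
  have h : p ∉ closure Uᶜ := by
    rw [hU.isClosed_compl.closure_eq]
    exact fun h => h hp
  rw [mem_closure_iff_aeval] at h
  push Not at h
  obtain ⟨d, f, hf, hzero, hne⟩ := h
  refine ⟨d, f, hf, hne, fun q hq => ?_⟩
  by_contra hqU
  exact hq (hzero q hqU)

/-- The points of `X` in the chart at which an ideal vanishes. -/
def chartLocus {K κ : Type*} [Field K] (X : Set (ℙ K (κ → K))) (k : κ)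
    (I : Ideal (MvPolynomial κ K)) : Set X :=
  {q | ∃ v ∈ coneChart (affineCone X) k, ∃ hv : v ≠ 0, (∀ f ∈ I, aeval v f = 0) ∧
    q.1 = Projectivization.mk K v hv}

theorem chartLocus_anti {K κ : Type*} [Field K] {X : Set (ℙ K (κ → K))} {k : κ}
    {I J : Ideal (MvPolynomial κ K)} (h : I ≤ J) :
    chartLocus X k J ⊆ chartLocus X k I := by
  rintro q ⟨v, hv, hv0, hvJ, hq⟩
  exact ⟨v, hv, hv0, fun f hf => hvJ f (h hf), hq⟩

theorem ne_zero_of_mem_coneChart {K κ : Type*} [Field K] {C : Set (κ → K)} {k : κ} {v : κ → K}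
    (hv : v ∈ coneChart C k) : v ≠ 0 := fun h => by
  have := hv.1
  simp [h] at this

variable {K : Type u} [Field K] [IsAlgClosed K] {κ : Type} [Finite κ] {X : Set (ℙ K (κ → K))}
  {k : κ}

/-- The Nullstellensatz for `I`; its zeros lie in the chart because the chart is Zariski closed. -/
theorem exists_mem_coneChart_of_notMem (hX : zariskiHull (affineCone X) ⊆ affineCone X)
    {I : Ideal (MvPolynomial κ K)} (hI : I.IsPrime)
    (hle : vanishingIdeal K (coneChart (affineCone X) k) ≤ I) {f : MvPolynomial κ K} (hf : f ∉ I) :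
    ∃ v ∈ coneChart (affineCone X) k, (∀ g ∈ I, aeval v g = 0) ∧ aeval v f ≠ 0 := by
  rw [← IsPrime.vanishingIdeal_zeroLocus (K := K) I] at hf
  obtain ⟨v, hv, hfv⟩ := notMem_vanishingIdeal.1 hf
  exact ⟨v, zariskiHull_coneChart hX k fun g hg => hv g (hle hg), hv, hfv⟩

theorem isIrreducible_chartLocus (hX : zariskiHull (affineCone X) ⊆ affineCone X)
    {I : Ideal (MvPolynomial κ K)} (hI : I.IsPrime)
    (hle : vanishingIdeal K (coneChart (affineCone X) k) ≤ I) :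
    IsIrreducible (chartLocus X k I) := by
  constructor
  · obtain ⟨v, hv, hvI, -⟩ := exists_mem_coneChart_of_notMem hX hI hle
      ((Ideal.ne_top_iff_one _).1 hI.ne_top)
    have hv0 := ne_zero_of_mem_coneChart hv
    exact ⟨⟨_, hv.2 hv0⟩, v, hv, hv0, hvI, rfl⟩
  · rintro U V hU hV ⟨p, ⟨v, hv, hv0, hvI, hpv⟩, hpU⟩ ⟨q, ⟨w, hw, hw0, hwI, hqw⟩, hqV⟩
    obtain ⟨U', hU', rfl⟩ := isOpen_induced_iff.1 hU
    obtain ⟨V', hV', rfl⟩ := isOpen_induced_iff.1 hV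
    obtain ⟨d, f, hf, hfp, hfU⟩ := exists_isHomogeneous_of_mem_isOpen hU' hpU
    obtain ⟨e, g, hg, hgq, hgV⟩ := exists_isHomogeneous_of_mem_isOpen hV' hqV
    rw [hpv, Ne, aeval_rep_eq_zero_iff hf] at hfp
    rw [hqw, Ne, aeval_rep_eq_zero_iff hg] at hgq
    obtain ⟨z, hz, hzI, hne⟩ := exists_mem_coneChart_of_notMem hX hI hle (mt hI.mem_or_mem
      (not_or.2 ⟨fun h => hfp (hvI f h), fun h => hgq (hwI g h)⟩))
    rw [map_mul] at hne
    have hz0 := ne_zero_of_mem_coneChart hz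
    refine ⟨⟨_, hz.2 hz0⟩, ⟨z, hz, hz0, hzI, rfl⟩, hfU _ ?_, hgV _ ?_⟩
    · rw [Ne, aeval_rep_eq_zero_iff hf]
      exact left_ne_zero_of_mul hne
    · rw [Ne, aeval_rep_eq_zero_iff hg]
      exact right_ne_zero_of_mul hne

/-- An element of `J` outside `I`, homogenized, cuts out a closed set containing the locus of `J`
but missing a point of the locus of `I`. -/
theorem not_closure_chartLocus_subset (hX : zariskiHull (affineCone X) ⊆ affineCone X)
    {I J : Ideal (MvPolynomial κ K)} (hI : I.IsPrime)
    (hle : vanishingIdeal K (coneChart (affineCone X) k) ≤ I) (h : I < J) :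
    ¬ closure (chartLocus X k I) ⊆ closure (chartLocus X k J) := by
  obtain ⟨f, hfJ, hfI⟩ := SetLike.exists_of_lt h
  obtain ⟨v, hv, hvI, hfv⟩ := exists_mem_coneChart_of_notMem hX hI hle hfI
  have hv0 := ne_zero_of_mem_coneChart hv
  have hhom := homogenizeAt_isHomogeneous k f
  intro hsub
  have hmem : (⟨_, hv.2 hv0⟩ : X) ∈ closure (chartLocus X k J) :=
    hsub (subset_closure ⟨v, hv, hv0, hvI, rfl⟩)
  have hcl : IsClosed {q : X | aeval q.1.rep (homogenizeAt k f) = 0} := by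
    have := (isOpen_setOf_aeval_rep_ne_zero hhom).isClosed_compl.preimage
      (continuous_subtype_val (p := fun q => q ∈ X))
    convert this using 1
    ext q
    simp
  have := closure_minimal (t := {q : X | aeval q.1.rep (homogenizeAt k f) = 0}) ?_ hcl hmem
  · change aeval (Projectivization.mk K v hv0).rep (homogenizeAt k f) = 0 at this
    rw [aeval_rep_eq_zero_iff hhom, aeval_homogenizeAt f hv.1] at this
    exact hfv this
  · rintro q ⟨w, hw, hw0, hwJ, hq⟩
    change aeval q.1.rep (homogenizeAt k f) = 0
    rw [hq, aeval_rep_eq_zero_iff hhom, aeval_homogenizeAt f hw.1]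
    exact hwJ f hfJ

theorem ringKrullDim_coneChart_le (hX : zariskiHull (affineCone X) ⊆ affineCone X) :
    ringKrullDim (CoordRing (coneChart (affineCone X) k)) ≤ dimension X := by
  set B := CoordRing (coneChart (affineCone X) k) with hB
  have hle : ∀ p : PrimeSpectrum B, vanishingIdeal K (coneChart (affineCone X) k) ≤
      p.asIdeal.comap (mk (coneChart (affineCone X) k)) := fun p f hf => by
    rw [Ideal.mem_comap, mk_eq_zero_iff.2 hf]
    exact zero_mem _
  have hprime : ∀ p : PrimeSpectrum B,
      (p.asIdeal.comap (mk (coneChart (affineCone X) k))).IsPrime := fun p =>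
    Ideal.IsPrime.comap _
  -- Larger primes give smaller closed sets, hence the order dual, which has the same Krull
  -- dimension.
  let Λ : PrimeSpectrum B → (TopologicalSpace.IrreducibleCloseds X)ᵒᵈ := fun p =>
    OrderDual.toDual ⟨closure (chartLocus X k (p.asIdeal.comap (mk _))),
      (isIrreducible_chartLocus hX (hprime p) (hle p)).closure, isClosed_closure⟩
  have hΛ : StrictMono Λ := fun p q hpq => by
    have hlt : p.asIdeal.comap (mk (coneChart (affineCone X) k)) <
        q.asIdeal.comap (mk (coneChart (affineCone X) k)) := by
      refine lt_of_le_not_ge (Ideal.comap_mono hpq.le) fun h => hpq.not_ge ?_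
      intro x hx
      obtain ⟨f, rfl⟩ := mk_surjective _ x
      exact h hx
    rw [← OrderDual.ofDual_lt_ofDual]
    refine lt_of_le_not_ge ?_ fun h => not_closure_chartLocus_subset hX (hprime p) (hle p) hlt h
    exact closure_mono (chartLocus_anti hlt.le)
  calc ringKrullDim B ≤ Order.krullDim (TopologicalSpace.IrreducibleCloseds X)ᵒᵈ :=
        Order.krullDim_le_of_strictMono Λ hΛ
    _ = dimension X := Order.krullDim_orderDual

/-- The dimension of the affine cone exceeds that of the projective variety by at most one. -/
theorem trdeg_affineCone_le {n : ℕ} (hcl : IsClosed X) (hne : X.Nonempty)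
    (hprime : (vanishingIdeal K (affineCone X)).IsPrime) (hdim : dimension X = n) :
    Algebra.trdeg K (CoordRing (affineCone X)) ≤ (n + 1 : ℕ) := by
  obtain ⟨p, hp⟩ := hne
  obtain ⟨k, hk⟩ := Function.ne_iff.1 p.rep_nonzero
  have hk' : MvPolynomial.X k ∉ vanishingIdeal K (affineCone X) :=
    notMem_vanishingIdeal.2 ⟨_, rep_mem_affineCone hp, by rwa [aeval_X]⟩
  have hdom := isDomain (isPrime_vanishingIdeal_coneChart smul_mem_affineCone hprime hk')
  obtain ⟨F, hF⟩ := exists_injective_coordRing_coneChart smul_mem_affineCone hprime hk'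
  obtain ⟨d, hd, hdle⟩ := exists_trdeg_polynomial_le (K := K)
    (A := CoordRing (coneChart (affineCone X) k))
  have hdn : d ≤ n := by
    have := hdle.trans (ringKrullDim_coneChart_le (zariskiHull_affineCone_subset hcl ⟨p, hp⟩))
    rw [hdim] at this
    exact_mod_cast this
  calc Algebra.trdeg K (CoordRing (affineCone X)) ≤ d + 1 :=
        (trdeg_le_of_injective F hF).trans hd.le
    _ ≤ (n + 1 : ℕ) := by exact_mod_cast Nat.add_le_add_right hdn 1

end Chart

end GrassmannSecants
end

theorem corollary3p2 {K : Type*} [Field K] [IsAlgClosed K] [CharZero K]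
    (r n s : ℕ) (hs : 1 ≤ s)
    (X : Set (ℙ K (Fin (r + 1) → K)))
    (hX : GrassmannSecants.IsNondegenerateVariety X)
    (hdim : GrassmannSecants.dimension X = n)
    (hcodim : (s : ℤ) < (r : ℤ) - (n : ℤ)) :
    GrassmannSecants.SIdentifiable (GrassmannSecants.segreProduct (Fin s) X) s := by
  have hC := hX.isNondegenerateCone
  obtain ⟨G, hG, hgen⟩ := GrassmannSecants.exists_general_tuples s hC
    (GrassmannSecants.trdeg_affineCone_le hX.isClosed hX.isIrreducible.1 hC.isPrime hdim)
    -- The cone has transcendence degree at most `n + 1` in a space of dimension `r + 1`, so the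
    -- count needed is `(n + 1) + s ≤ r + 1`.
    (by rw [Fintype.card_fin]; omega)
  have : Nonempty (Fin s) := ⟨⟨0, hs⟩⟩
  have h := GrassmannSecants.sIdentifiable_of_general_tuples hX hG fun x hx hGx => by
    refine ⟨(hgen x hx hGx).1, fun c hc => (hgen x hx hGx).2 c ?_⟩
    refine GrassmannSecants.subset_zariskiHull _ ?_
    convert hc using 1
    ext k
    simp
  rwa [Fintype.card_fin] at h
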